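/- Let $\omega_A,\omega_c\in\mathbb R$, $\gamma\ge 0$ and $g,z\in\mathbb C$. On $\mathbb C^2\otimes\ell^2(\mathbb N)$ (a two-level atom $A$ with raising and lowering operators $\sigma^\pm$, and a bosonic mode $B$ with annihilation operator $b$) consider the superoperators $$\mathcal L_0\rho=-i[\omega_A\sigma^+\sigma^-+\omega_c b^\dagger b,\rho]+\gamma\bigl(b\rho b^\dagger-\tfrac12\{b^\dagger b,\rho\}\bigr),\qquad \mathcal L\rho=-i[g\sigma^+b+\bar g\sigma^-b^\dagger,\rho],$$ and the projector $\mathcal P\rho=\rho_A\otimes|z\rangle\langle z|$, where $\rho_A=\operatorname{tr}_B\rho$ and $|z\rangle$ is the normalized coherent state, $b|z\rangle=z|z\rangle$. Then $\mathcal L_0$, on operators with finitely many nonzero matrix elements in the Fock basis, generates a strongly continuous semigroup $e^{\mathcal L_0t}$, $t\ge0$, on the trace class (and the following holds for every such semigroup). Define the moments $$\mathcal O_0(t)=\mathcal Pe^{\mathcal L_0t}\mathcal P,\qquad \mathcal O_1(t)=\int_0^t\mathcal Pe^{\mathcal L_0(t-s)}\mathcal Le^{\mathcal L_0s}\mathcal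 P\,ds,$$ and the first-order cumulant $$\mathcal K_1(t)=\dot{\mathcal O}_1\mathcal O_0^{-1}-\dot{\mathcal O}_0\mathcal O_0^{-1}\mathcal O_1\mathcal O_0^{-1},$$ where $\mathcal O_0(t)^{-1}$ is the inverse of $\mathcal O_0(t)$ on the range of $\mathcal P$, extended by zero to the kernel of $\mathcal P$; time derivatives at $t=0$ are one-sided. Then for all $t\ge0$ all these expressions are well defined ($\mathcal O_0(t)$ is a bijection of the range of $\mathcal P$, the integrand exists and is integrable, $\mathcal O_0$ and $\mathcal O_1$ are differentiable, the integral and the derivatives being taken matrix element by matrix element), and for every trace-class $\rho$ $$\mathcal K_1(t)\rho=-i\,e^{-\gamma t/2}\bigl[g z e^{-i\omega_ct}\sigma^++\bar g\bar z e^{i\omega_ct}\sigma^-,\ \rho_A\bigr]\otimes|z\rangle\langle z|.$$ Equivalently, $\mathcal K_1(t)\rho=-i[g z(t)\sigma^++\bar g\,\overline{z(t)}\sigma^-,\rho_A]\otimes|z\rangle\langle z|$ with $z(t)=z e^{(-i\omega_c-\gamma/2)t}$: this is the parametric approximation ($b$ replaced by the c-number $z(t)$) with exponential pump depletion. If $g\neq0$,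 then for every $t\ge0$ the superoperator $\mathcal K_1(t)$ vanishes if and only if $z=0$. -/

import Mathlib

open scoped Kronecker

noncomputable section

namespace DissipativeJC

/-! ### Operators as infinite matrices

The two-level atom has basis `Fin 2` (`0` = ground, `1` = excited), the bosonic mode has the Fock
basis `ℕ`, and the composite system has the product basis.  Operators are written as (infinite)
matrices in these orthonormal bases. -/

/-- Operators on the atom. -/
abbrev AtomOp := Matrix (Fin 2) (Fin 2) ℂ

/-- Operators on the bosonic mode, as matrices in the Fock basis. -/
abbrev ModeOp := Matrix ℕ ℕ ℂ

/-- Operators on atom ⊗ mode, as matrices in the product basis. -/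
abbrev JointOp := Matrix (Fin 2 × ℕ) (Fin 2 × ℕ) ℂ

/-- Product of infinite matrices.  In all uses below one of the factors has at most one nonzero
entry in each row and column, so that the sum is finite. -/
def opMul {ι : Type} (A B : Matrix ι ι ℂ) : Matrix ι ι ℂ :=
  Matrix.of fun i j => ∑' k, A i k * B k j

infixl:70 " ⋄ " => opMul

/-- The raising operator `σ⁺ = |1⟩⟨0|` of the atom. -/
def sigmaPlus : AtomOp := !![0, 0; 1, 0]

/-- The lowering operator `σ⁻ = |0⟩⟨1|` of the atom. -/
def sigmaMinus : AtomOp := !![0, 1; 0, 0]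

/-- The annihilation operator of the mode: `b |n⟩ = √n |n - 1⟩`. -/
def annihilation : ModeOp := Matrix.of fun m n => if n = m + 1 then ((Real.sqrt n : ℝ) : ℂ) else 0

/-- The creation operator `b†`. -/
def creation : ModeOp := annihilation.conjTranspose

/-- The coherent state `|z⟩`, the normalized eigenvector of `b` with eigenvalue `z`. -/
def coherent (z : ℂ) : ℕ → ℂ := fun n =>
  (Real.exp (-‖z‖ ^ 2 / 2) : ℂ) * z ^ n / ((Real.sqrt (n.factorial : ℝ) : ℝ) : ℂ)

/-- The coherent projector `|z⟩⟨z|`. -/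
def coherentProj (z : ℂ) : ModeOp := Matrix.of fun m n => coherent z m * star (coherent z n)

/-! ### Trace class -/

/-- `X = ∑ₖ |uₖ⟩⟨vₖ|` with `∑ₖ ‖uₖ‖ ‖vₖ‖ < ∞`, the vectors being square-summable. -/
def IsNuclearRep {ι : Type} (X : Matrix ι ι ℂ) (u v : ℕ → lp (fun _ : ι => ℂ) 2) : Prop :=
  Summable (fun k => ‖u k‖ * ‖v k‖) ∧
    ∀ i j, HasSum (fun k => (u k : ι → ℂ) i * star ((v k : ι → ℂ) j)) (X i j)

/-- Trace-class (nuclear) operators on `ℓ²(ι)`. -/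
def IsTraceClass {ι : Type} (X : Matrix ι ι ℂ) : Prop := ∃ u v, IsNuclearRep X u v

/-- The trace norm, as the infimum of `∑ₖ ‖uₖ‖ ‖vₖ‖` over all nuclear representations. -/
def traceNorm {ι : Type} (X : Matrix ι ι ℂ) : ℝ :=
  sInf {c | ∃ u v, IsNuclearRep X u v ∧ c = ∑' k, ‖u k‖ * ‖v k‖}

/-- Matrices with finitely many nonzero entries. -/
def IsFinitelySupported {ι : Type} (X : Matrix ι ι ℂ) : Prop :=
  {p : ι × ι | X p.1 p.2 ≠ 0}.Finite

/-- Partial trace over the mode. -/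
def partialTrace (X : JointOp) : AtomOp := Matrix.of fun i j => ∑' n : ℕ, X (i, n) (j, n)

/-! ### The dissipative Jaynes-Cummings model -/

/-- `H_A + H_B = ω_A σ⁺σ⁻ + ω_c b†b`. -/
def freeHamiltonian (ωA ωc : ℝ) : JointOp :=
  (ωA : ℂ) • ((sigmaPlus * sigmaMinus) ⊗ₖ (1 : ModeOp)) +
    (ωc : ℂ) • ((1 : AtomOp) ⊗ₖ (creation ⋄ annihilation))

/-- `H_I = g σ⁺ b + ḡ σ⁻ b†`. -/
def interactionHamiltonian (g : ℂ) : JointOp :=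
  g • (sigmaPlus ⊗ₖ annihilation) + star g • (sigmaMinus ⊗ₖ creation)

/-- The dissipator `𝒟 X = γ (b X b† - ½ {b†b, X})` of the mode. -/
def dissipator (γ : ℝ) (X : JointOp) : JointOp :=
  (γ : ℂ) • ((1 : AtomOp) ⊗ₖ annihilation ⋄ X ⋄ ((1 : AtomOp) ⊗ₖ creation) -
    (1 / 2 : ℂ) • ((1 : AtomOp) ⊗ₖ (creation ⋄ annihilation) ⋄ X +
      X ⋄ ((1 : AtomOp) ⊗ₖ (creation ⋄ annihilation))))

/-- The free generator `𝓛₀ X = -i [H_A + H_B, X] + 𝒟 X`. -/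
def freeGenerator (ωA ωc γ : ℝ) (X : JointOp) : JointOp :=
  (-Complex.I) • (freeHamiltonian ωA ωc ⋄ X - X ⋄ freeHamiltonian ωA ωc) + dissipator γ X

/-- The interaction superoperator `𝓛 X = -i [H_I, X]`. -/
def interaction (g : ℂ) (X : JointOp) : JointOp :=
  (-Complex.I) • (interactionHamiltonian g ⋄ X - X ⋄ interactionHamiltonian g)

/-- `T` is the semigroup `T s = e^{𝒢 s}`, `s ≥ 0`, on the trace class: it is a strongly continuous
one-parameter semigroup of bounded linear maps in trace norm, and its generator is `𝒢` on the
finitely supported matrices.  The values of `T s` off the trace class and of `T` at negative times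
are arbitrary and are never used. -/
structure IsSemigroupGeneratedBy (𝒢 : JointOp → JointOp) (T : ℝ → JointOp → JointOp) : Prop where
  map_traceClass : ∀ s, 0 ≤ s → ∀ X, IsTraceClass X → IsTraceClass (T s X)
  map_add : ∀ s, 0 ≤ s → ∀ X Y, IsTraceClass X → IsTraceClass Y → T s (X + Y) = T s X + T s Y
  map_smul : ∀ s, 0 ≤ s → ∀ (c : ℂ) (X), IsTraceClass X → T s (c • X) = c • T s X
  bound : ∃ M w : ℝ, ∀ s, 0 ≤ s → ∀ X, IsTraceClass X →
    traceNorm (T s X) ≤ M * Real.exp (w * s) * traceNorm X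
  zero : ∀ X, IsTraceClass X → T 0 X = X
  add : ∀ s r, 0 ≤ s → 0 ≤ r → ∀ X, IsTraceClass X → T (s + r) X = T s (T r X)
  continuous : ∀ X, IsTraceClass X →
    Filter.Tendsto (fun s => traceNorm (T s X - X)) (nhdsWithin 0 (Set.Ioi 0)) (nhds 0)
  generator : ∀ X, IsFinitelySupported X →
    Filter.Tendsto (fun s : ℝ => traceNorm (((s⁻¹ : ℝ) : ℂ) • (T s X - X) - 𝒢 X))
      (nhdsWithin 0 (Set.Ioi 0)) (nhds 0)

/-! ### Projector, moments and the first-order cumulant -/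

/-- The projector `𝒫 X = tr_B(X) ⊗ |z⟩⟨z|`. -/
def proj (z : ℂ) (X : JointOp) : JointOp := partialTrace X ⊗ₖ coherentProj z

/-- The range of `𝒫` on the trace class. -/
def projRange (z : ℂ) : Set JointOp := proj z '' {X | IsTraceClass X}

/-- The zeroth moment `𝒪₀(t) = 𝒫 e^{𝓛₀ t} 𝒫`. -/
def moment0 (z : ℂ) (T : ℝ → JointOp → JointOp) (t : ℝ) (X : JointOp) : JointOp :=
  proj z (T t (proj z X))

/-- `𝒫 e^{𝓛₀ t} 𝓛(s) 𝒫 = 𝒫 e^{𝓛₀ (t - s)} 𝓛 e^{𝓛₀ s} 𝒫` for `0 ≤ s ≤ t`. -/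
def moment1Integrand (g z : ℂ) (T : ℝ → JointOp → JointOp) (t s : ℝ) (X : JointOp) : JointOp :=
  proj z (T (t - s) (interaction g (T s (proj z X))))

/-- The first moment `𝒪₁(t) = ∫₀ᵗ 𝒫 e^{𝓛₀ t} 𝓛(s) 𝒫 ds`. -/
def moment1 (g z : ℂ) (T : ℝ → JointOp → JointOp) (t : ℝ) (X : JointOp) : JointOp :=
  Matrix.of fun i j => ∫ s in (0 : ℝ)..t, moment1Integrand g z T t s X i j

/-- The time derivative of a family of superoperators given for times `≥ 0` (one-sided at `0`). -/
def timeDeriv (O : ℝ → JointOp → JointOp) (t : ℝ) (X : JointOp) : JointOp :=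
  Matrix.of fun i j => derivWithin (fun s => O s X i j) (Set.Ici 0) t

/-- `𝒪₀(t)⁻¹`: the inverse of `𝒪₀(t)` on the range of `𝒫` (and zero on the kernel of `𝒫`). -/
def moment0Inv (z : ℂ) (T : ℝ → JointOp → JointOp) (t : ℝ) (X : JointOp) : JointOp :=
  Function.invFunOn (moment0 z T t) (projRange z) (proj z X)

/-- The first-order cumulant `𝒦₁(t) = 𝒪̇₁ 𝒪₀⁻¹ - 𝒪̇₀ 𝒪₀⁻¹ 𝒪₁ 𝒪₀⁻¹`. -/
def cumulant1 (g z : ℂ) (T : ℝ → JointOp → JointOp) (t : ℝ) (X : JointOp) : JointOp :=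
  timeDeriv (moment1 g z T) t (moment0Inv z T t X) -
    timeDeriv (moment0 z T) t (moment0Inv z T t (moment1 g z T t (moment0Inv z T t X)))

/-- All expressions that enter `𝒦₁(t)` make sense: `𝒪₀(t)` is invertible on the range of `𝒫`,
the integrand of `𝒪₁(t)` consists of trace-class operators and is integrable, `𝒪₁(t)` maps into
the range of `𝒫`, and both moments are differentiable in time. -/
structure CumulantWellDefined (g z : ℂ) (T : ℝ → JointOp → JointOp) (t : ℝ) : Prop where
  proj_traceClass : ∀ X, IsTraceClass X → IsTraceClass (proj z X)
  proj_proj : ∀ X, IsTraceClass X → proj z (proj z X) = proj z X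
  bijOn : Set.BijOn (moment0 z T t) (projRange z) (projRange z)
  interaction_traceClass : ∀ X, IsTraceClass X → ∀ s, 0 ≤ s → s ≤ t →
    IsTraceClass (interaction g (T s (proj z X)))
  integrable : ∀ X, IsTraceClass X → ∀ i j,
    IntervalIntegrable (fun s => moment1Integrand g z T t s X i j) MeasureTheory.volume 0 t
  moment1_mem : ∀ X, IsTraceClass X → moment1 g z T t X ∈ projRange z
  differentiable0 : ∀ X, IsTraceClass X → ∀ i j,
    DifferentiableWithinAt ℝ (fun s => moment0 z T s X i j) (Set.Ici 0) t
  differentiable1 : ∀ X, IsTraceClass X → ∀ i j,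
    DifferentiableWithinAt ℝ (fun s => moment1 g z T s X i j) (Set.Ici 0) t

/-- The Hamiltonian of the parametric approximation: `b` and `b†` in `H_I` are replaced by the
c-numbers `w` and `w̄`. -/
def parametricHamiltonian (g w : ℂ) : AtomOp :=
  (g * w) • sigmaPlus + (star g * star w) • sigmaMinus

end DissipativeJC

end

namespace DissipativeJC

open Filter Topology

/-! ### Trace class operators -/

section TraceClass

variable {ι : Type}

/-! The proof solves the damped mode explicitly. In time `t` each photon is lost independently with
probability `q = 1 - e^{-γt}`, so the semigroup is a sum `∑ₖ Kₖ X Kₖ†`, where `Kₖ` removes `k`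
photons with a binomial weight and the free phases. This is `freeEvolution`. Its contractivity, its
semigroup law and its compatibility with the partial trace all reduce to one identity, the binomial
theorem summed against a sequence (`hasSum_choose_mul`).

Loss never raises the photon number, so matrices with fewer than `N` photons form an invariant
finite-dimensional space. There the generator is found entry by entry, and strong continuity follows
by density and contractivity. Uniqueness (`eq_freeEvolution`) uses the same spaces: a second
semigroup with the same generator differs from the explicit one by `o(h)` in a step of length `h`,
and telescoping over `n` steps of length `t / n` leaves an error that tends to zero. Density extends
the equality to the trace class, so the explicit formulas hold for every admissible semigroup.

Three facts then determine the cumulant. Tracing out the mode turns the evolution into the unitary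
evolution of the atom (`partialTrace_freeEvolution`). A coherent state stays coherent with amplitude
`z(t)` (`freeEvolution_kronecker_coherentProj`). The partial trace of the interaction on `A ⊗
|w⟩⟨w|` is the parametric commutator, because `tr(b |w⟩⟨w|) = w` (`partialTrace_interaction`).
Writing `U_t` for the atomic evolution, `𝒪₀` acts as `U_t` and `𝒪₁` as `U_t` applied to an integral
of `U_{-s}` of the drift. In `𝒪̇₁` the derivative of the outer `U_t` is cancelled by the second term
of the cumulant, and only the drift at the endpoint remains, with `U_t U_{-t} ρ_A = ρ_A` inside the
commutator. Testing on the atomic ground state isolates `g z(t)`, which vanishes only with `z` when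
`g ≠ 0`. -/

lemma hasSum_norm_sq (f : lp (fun _ : ι => ℂ) 2) : HasSum (fun i => ‖f i‖ ^ 2) (‖f‖ ^ 2) := by
  simpa using lp.hasSum_norm (p := 2) (by norm_num) f

lemma memℓp_two_iff {f : ι → ℂ} : Memℓp f 2 ↔ Summable fun i => ‖f i‖ ^ 2 := by
  simpa using memℓp_gen_iff (p := 2) (f := f) (by norm_num)

lemma sum_norm_sq_comp_le {κ : Type} (f : lp (fun _ : ι => ℂ) 2) {a : κ → ι}
    (ha : Function.Injective a) (s : Finset κ) : ∑ n ∈ s, ‖f (a n)‖ ^ 2 ≤ ‖f‖ ^ 2 := by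
  have h := sum_le_hasSum (s.map ⟨a, ha⟩) (fun i _ => sq_nonneg ‖f i‖) (hasSum_norm_sq f)
  simpa using h

/-- Cauchy–Schwarz along two injective reindexings; it controls every shifted diagonal of a rank-one
matrix at once. -/
lemma sum_norm_mul_norm_le {κ : Type} (f g : lp (fun _ : ι => ℂ) 2) {a b : κ → ι}
    (ha : Function.Injective a) (hb : Function.Injective b) (s : Finset κ) :
    ∑ n ∈ s, ‖f (a n)‖ * ‖g (b n)‖ ≤ ‖f‖ * ‖g‖ := by
  refine (Real.sum_mul_le_sqrt_mul_sqrt s _ _).trans ?_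
  gcongr
  · exact Real.sqrt_le_iff.2 ⟨norm_nonneg _, sum_norm_sq_comp_le f ha s⟩
  · exact Real.sqrt_le_iff.2 ⟨norm_nonneg _, sum_norm_sq_comp_le g hb s⟩

/-! ### The trace norm: triangle inequality and scaling -/

lemma traceNorm_bddBelow (X : Matrix ι ι ℂ) :
    BddBelow {c | ∃ u v, IsNuclearRep X u v ∧ c = ∑' k, ‖u k‖ * ‖v k‖} :=
  ⟨0, by rintro _ ⟨u, v, -, rfl⟩; exact tsum_nonneg fun k => by positivity⟩

lemma traceNorm_nonneg (X : Matrix ι ι ℂ) : 0 ≤ traceNorm X :=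
  Real.sInf_nonneg (by rintro _ ⟨u, v, -, rfl⟩; exact tsum_nonneg fun k => by positivity)

/-- Nuclear representations may be indexed by any countable type. -/
lemma traceClass_of_hasSum {κ : Type} [Countable κ] {X : Matrix ι ι ℂ}
    {u v : κ → lp (fun _ : ι => ℂ) 2} (hs : Summable fun k => ‖u k‖ * ‖v k‖)
    (hX : ∀ i j, HasSum (fun k => (u k : ι → ℂ) i * star ((v k : ι → ℂ) j)) (X i j)) :
    IsTraceClass X ∧ traceNorm X ≤ ∑' k, ‖u k‖ * ‖v k‖ := by
  obtain ⟨f, hf⟩ := exists_injective_nat κ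
  have key : (fun n => ‖Function.extend f u 0 n‖ * ‖Function.extend f v 0 n‖) =
      Function.extend f (fun k => ‖u k‖ * ‖v k‖) 0 := by
    ext n
    by_cases hn : ∃ k, f k = n
    · obtain ⟨k, rfl⟩ := hn
      simp [hf.extend_apply]
    · simp [Function.extend_apply' _ _ _ hn]
  have key2 (i j : ι) : (fun n => ((Function.extend f u 0 n : lp (fun _ : ι => ℂ) 2) : ι → ℂ) i *
      star (((Function.extend f v 0 n : lp (fun _ : ι => ℂ) 2) : ι → ℂ) j)) =
      Function.extend f (fun k => (u k : ι → ℂ) i * star ((v k : ι → ℂ) j)) 0 := by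
    ext n
    by_cases hn : ∃ k, f k = n
    · obtain ⟨k, rfl⟩ := hn
      simp [hf.extend_apply]
    · simp [Function.extend_apply' _ _ _ hn]
  have h1 := (hasSum_extend_zero hf).2 hs.hasSum
  have hrep : IsNuclearRep X (Function.extend f u 0) (Function.extend f v 0) :=
    ⟨by rw [key]; exact h1.summable,
      fun i j => by rw [key2]; exact (hasSum_extend_zero hf).2 (hX i j)⟩
  refine ⟨⟨_, _, hrep⟩, csInf_le (traceNorm_bddBelow X) ⟨_, _, hrep, ?_⟩⟩
  rw [key, h1.tsum_eq]

/-- Trace class is needed here: without a representation the infimum runs over the empty set and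
equals `0`. -/
lemma le_traceNorm {X : Matrix ι ι ℂ} (hX : IsTraceClass X) {c : ℝ}
    (h : ∀ u v, IsNuclearRep X u v → c ≤ ∑' k, ‖u k‖ * ‖v k‖) : c ≤ traceNorm X := by
  obtain ⟨u, v, huv⟩ := hX
  refine le_csInf ⟨_, u, v, huv, rfl⟩ ?_
  rintro _ ⟨u, v, huv, rfl⟩
  exact h u v huv

lemma exists_nuclearRep_lt {X : Matrix ι ι ℂ} (hX : IsTraceClass X) {ε : ℝ} (hε : 0 < ε) :
    ∃ u v, IsNuclearRep X u v ∧ ∑' k, ‖u k‖ * ‖v k‖ < traceNorm X + ε := by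
  obtain ⟨u, v, huv⟩ := hX
  obtain ⟨_, ⟨u, v, h, rfl⟩, hlt⟩ := Real.lt_sInf_add_pos
    (s := {c | ∃ u v, IsNuclearRep X u v ∧ c = ∑' k, ‖u k‖ * ‖v k‖}) ⟨_, u, v, huv, rfl⟩ hε
  exact ⟨u, v, h, hlt⟩

/-- Two nuclear representations are concatenated over `ℕ ⊕ ℕ`, each chosen within `ε / 2` of the
infimum. -/
lemma IsTraceClass.add_and_le {X Y : Matrix ι ι ℂ} (hX : IsTraceClass X) (hY : IsTraceClass Y) :
    IsTraceClass (X + Y) ∧ traceNorm (X + Y) ≤ traceNorm X + traceNorm Y := by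
  have main : ∀ u v u' v', IsNuclearRep X u v → IsNuclearRep Y u' v' → IsTraceClass (X + Y) ∧
      traceNorm (X + Y) ≤ ∑' k, ‖u k‖ * ‖v k‖ + ∑' k, ‖u' k‖ * ‖v' k‖ := by
    intro u v u' v' h h'
    have hs : HasSum (fun k : ℕ ⊕ ℕ => ‖Sum.elim u u' k‖ * ‖Sum.elim v v' k‖)
      (∑' k, ‖u k‖ * ‖v k‖ + ∑' k, ‖u' k‖ * ‖v' k‖) := HasSum.sum h.1.hasSum h'.1.hasSum
    rw [← hs.tsum_eq]
    exact traceClass_of_hasSum hs.summable fun i j => HasSum.sum (h.2 i j) (h'.2 i j)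
  refine ⟨?_, le_of_forall_pos_le_add fun ε hε => ?_⟩
  · obtain ⟨u, v, h⟩ := hX
    obtain ⟨u', v', h'⟩ := hY
    exact (main u v u' v' h h').1
  · obtain ⟨u, v, h, hl⟩ := exists_nuclearRep_lt hX (half_pos hε)
    obtain ⟨u', v', h', hl'⟩ := exists_nuclearRep_lt hY (half_pos hε)
    linarith [(main u v u' v' h h').2]

lemma IsTraceClass.add {X Y : Matrix ι ι ℂ} (hX : IsTraceClass X) (hY : IsTraceClass Y) :
    IsTraceClass (X + Y) := (hX.add_and_le hY).1

lemma traceNorm_add_le {X Y : Matrix ι ι ℂ} (hX : IsTraceClass X) (hY : IsTraceClass Y) :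
    traceNorm (X + Y) ≤ traceNorm X + traceNorm Y := (hX.add_and_le hY).2

lemma isTraceClass_zero : IsTraceClass (0 : Matrix ι ι ℂ) :=
  ⟨0, 0, by simp [IsNuclearRep, summable_zero, hasSum_zero]⟩

lemma traceNorm_zero : traceNorm (0 : Matrix ι ι ℂ) = 0 := by
  refine le_antisymm (csInf_le (traceNorm_bddBelow _) ⟨0, 0, ?_, by simp⟩) (traceNorm_nonneg _)
  simp [IsNuclearRep, summable_zero, hasSum_zero]

lemma IsTraceClass.smul_and_le (c : ℂ) {X : Matrix ι ι ℂ} (hX : IsTraceClass X) :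
    IsTraceClass (c • X) ∧ traceNorm (c • X) ≤ ‖c‖ * traceNorm X := by
  have main : ∀ u v, IsNuclearRep X u v → IsTraceClass (c • X) ∧
      traceNorm (c • X) ≤ ‖c‖ * ∑' k, ‖u k‖ * ‖v k‖ := by
    intro u v h
    have hs : HasSum (fun k => ‖c • u k‖ * ‖v k‖) (‖c‖ * ∑' k, ‖u k‖ * ‖v k‖) := by
      simpa [norm_smul, mul_assoc] using h.1.hasSum.mul_left ‖c‖
    rw [← hs.tsum_eq]
    refine traceClass_of_hasSum hs.summable fun i j => ?_
    simpa [mul_assoc] using (h.2 i j).mul_left c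
  refine ⟨?_, le_of_forall_pos_le_add fun ε hε => ?_⟩
  · obtain ⟨u, v, h⟩ := hX
    exact (main u v h).1
  -- Dividing by `‖c‖ + 1` instead of `‖c‖` also covers `c = 0`.
  · obtain ⟨u, v, h, hl⟩ := exists_nuclearRep_lt hX (ε := ε / (‖c‖ + 1)) (by positivity)
    refine (main u v h).2.trans ?_
    have h3 : ‖c‖ * (ε / (‖c‖ + 1)) ≤ ε := by
      rw [mul_div_assoc', div_le_iff₀ (by positivity)]
      nlinarith [norm_nonneg c]
    nlinarith [mul_le_mul_of_nonneg_left hl.le (norm_nonneg c)]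

lemma IsTraceClass.smul (c : ℂ) {X : Matrix ι ι ℂ} (hX : IsTraceClass X) :
    IsTraceClass (c • X) := (hX.smul_and_le c).1

lemma traceNorm_smul_le (c : ℂ) {X : Matrix ι ι ℂ} (hX : IsTraceClass X) :
    traceNorm (c • X) ≤ ‖c‖ * traceNorm X := (hX.smul_and_le c).2

lemma IsTraceClass.neg {X : Matrix ι ι ℂ} (hX : IsTraceClass X) : IsTraceClass (-X) := by
  simpa using hX.smul (-1)

lemma IsTraceClass.sub {X Y : Matrix ι ι ℂ} (hX : IsTraceClass X) (hY : IsTraceClass Y) :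
    IsTraceClass (X - Y) := by
  rw [sub_eq_add_neg]; exact hX.add hY.neg

lemma traceNorm_sub_comm {X Y : Matrix ι ι ℂ} (hX : IsTraceClass X) (hY : IsTraceClass Y) :
    traceNorm (X - Y) = traceNorm (Y - X) := by
  have h1 := traceNorm_smul_le (-1) (hX.sub hY)
  have h2 := traceNorm_smul_le (-1) (hY.sub hX)
  simp only [neg_smul, one_smul, neg_sub, norm_neg, norm_one, one_mul] at h1 h2
  exact le_antisymm h2 h1

lemma traceNorm_sub_le {X Y Z : Matrix ι ι ℂ} (hX : IsTraceClass X) (hY : IsTraceClass Y)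
    (hZ : IsTraceClass Z) : traceNorm (X - Z) ≤ traceNorm (X - Y) + traceNorm (Y - Z) := by
  simpa using traceNorm_add_le (hX.sub hY) (hY.sub hZ)

lemma isTraceClass_sum {κ : Type} {s : Finset κ} {X : κ → Matrix ι ι ℂ}
    (h : ∀ k ∈ s, IsTraceClass (X k)) : IsTraceClass (∑ k ∈ s, X k) :=
  Finset.sum_induction X IsTraceClass (fun _ _ => IsTraceClass.add) isTraceClass_zero h

lemma traceNorm_sum_le {κ : Type} {s : Finset κ} {X : κ → Matrix ι ι ℂ}
    (h : ∀ k ∈ s, IsTraceClass (X k)) :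
    traceNorm (∑ k ∈ s, X k) ≤ ∑ k ∈ s, traceNorm (X k) := by
  classical
  induction s using Finset.induction_on with
  | empty => simp [traceNorm_zero]
  | insert a s ha ih =>
    rw [Finset.sum_insert ha, Finset.sum_insert ha]
    have h' : ∀ k ∈ s, IsTraceClass (X k) := fun k hk => h k (Finset.mem_insert_of_mem hk)
    linarith [ih h', traceNorm_add_le (h a (Finset.mem_insert_self _ _)) (isTraceClass_sum h')]

lemma traceClass_rankOne (u v : lp (fun _ : ι => ℂ) 2) :
    IsTraceClass (Matrix.of fun i j => u i * star (v j)) ∧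
      traceNorm (Matrix.of fun i j => u i * star (v j)) ≤ ‖u‖ * ‖v‖ := by
  have h := traceClass_of_hasSum (κ := Unit) (X := Matrix.of fun i j => u i * star (v j))
    (u := fun _ => u) (v := fun _ => v) (hasSum_unique _).summable
    (fun i j => hasSum_unique (fun _ : Unit => u i * star (v j)))
  simpa using h

lemma traceClass_single [DecidableEq ι] (i j : ι) (c : ℂ) :
    IsTraceClass (Matrix.single i j c) ∧ traceNorm (Matrix.single i j c) ≤ ‖c‖ := by
  have h := traceClass_rankOne (lp.single 2 i c) (lp.single 2 j (1 : ℂ))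
  have e : (Matrix.of fun a b => (lp.single 2 i c : lp (fun _ : ι => ℂ) 2) a *
      star ((lp.single 2 j (1 : ℂ) : lp (fun _ : ι => ℂ) 2) b)) = Matrix.single i j c := by
    ext a b
    simp only [Matrix.of_apply, lp.single_apply, Matrix.single, Pi.single_apply]
    by_cases h1 : i = a <;> by_cases h2 : j = b <;> simp [h1, h2, eq_comm (a := a), eq_comm (a := b)]
  rw [e, lp.norm_single (by norm_num), lp.norm_single (by norm_num)] at h
  simpa using h

lemma eq_sum_single [DecidableEq ι] {X : Matrix ι ι ℂ} {s : Finset ι}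
    (h : ∀ i j, X i j ≠ 0 → i ∈ s ∧ j ∈ s) :
    X = ∑ p ∈ s ×ˢ s, Matrix.single p.1 p.2 (X p.1 p.2) := by
  ext i j
  rw [Matrix.sum_apply]
  by_cases hij : X i j = 0
  · rw [hij, Finset.sum_eq_zero]
    rintro ⟨a, b⟩ -
    by_cases hab : a = i ∧ b = j
    · simp [hab.1, hab.2, hij]
    · exact Matrix.single_apply_of_ne _ _ _ _ _ hab
  · rw [Finset.sum_eq_single (i, j)]
    · simp
    · rintro ⟨a, b⟩ - hne
      refine Matrix.single_apply_of_ne _ _ _ _ _ ?_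
      rintro ⟨rfl, rfl⟩
      exact hne rfl
    · intro hn
      exact absurd (Finset.mem_product.2 (h i j hij)) hn

lemma traceClass_of_support {X : Matrix ι ι ℂ} {s : Finset ι}
    (h : ∀ i j, X i j ≠ 0 → i ∈ s ∧ j ∈ s) :
    IsTraceClass X ∧ traceNorm X ≤ ∑ p ∈ s ×ˢ s, ‖X p.1 p.2‖ := by
  classical
  have h1 : ∀ p ∈ s ×ˢ s, IsTraceClass (Matrix.single p.1 p.2 (X p.1 p.2)) :=
    fun p _ => (traceClass_single _ _ _).1
  constructor
  · rw [eq_sum_single h]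
    exact isTraceClass_sum h1
  · conv_lhs => rw [eq_sum_single h]
    exact (traceNorm_sum_le h1).trans (Finset.sum_le_sum fun p _ => (traceClass_single _ _ _).2)

/-! ### Bounds on entries, and density of finitely supported matrices -/

lemma IsFinitelySupported.exists_finset {X : Matrix ι ι ℂ} (hX : IsFinitelySupported X) :
    ∃ s : Finset ι, ∀ i j, X i j ≠ 0 → i ∈ s ∧ j ∈ s := by
  classical
  refine ⟨hX.toFinset.image Prod.fst ∪ hX.toFinset.image Prod.snd, fun i j hij => ?_⟩
  have : (i, j) ∈ hX.toFinset := (Set.Finite.mem_toFinset hX).2 hij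
  exact ⟨Finset.mem_union_left _ (Finset.mem_image_of_mem Prod.fst this),
    Finset.mem_union_right _ (Finset.mem_image_of_mem Prod.snd this)⟩

lemma isFinitelySupported_of_support {X : Matrix ι ι ℂ} {s : Finset ι}
    (h : ∀ i j, X i j ≠ 0 → i ∈ s ∧ j ∈ s) : IsFinitelySupported X :=
  (s ×ˢ s).finite_toSet.subset fun p hp => by simpa using h p.1 p.2 hp

/-- Each rank-one term obeys the bound by Cauchy–Schwarz, and finite sums commute with the series.
For shifted diagonals this gives convergence of the Kraus sum and of the partial trace; for a single
entry it bounds the entry by the trace norm. -/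
lemma sum_norm_apply_le_traceNorm {κ : Type} {X : Matrix ι ι ℂ} (hX : IsTraceClass X) {a b : κ → ι}
    (ha : Function.Injective a) (hb : Function.Injective b) (s : Finset κ) :
    ∑ n ∈ s, ‖X (a n) (b n)‖ ≤ traceNorm X := by
  refine le_traceNorm hX fun u v h => ?_
  have hle (f g : lp (fun _ : ι => ℂ) 2) (i j : ι) : ‖f i * star (g j)‖ ≤ ‖f‖ * ‖g‖ := by
    rw [norm_mul, norm_star]
    gcongr <;> exact lp.norm_apply_le_norm (by norm_num) _ _
  have hsum (i j : ι) : Summable fun k => ‖(u k : ι → ℂ) i * star ((v k : ι → ℂ) j)‖ :=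
    Summable.of_nonneg_of_le (fun _ => norm_nonneg _) (fun k => hle _ _ _ _) h.1
  calc ∑ n ∈ s, ‖X (a n) (b n)‖
      ≤ ∑ n ∈ s, ∑' k, ‖(u k : ι → ℂ) (a n) * star ((v k : ι → ℂ) (b n))‖ := by
        refine Finset.sum_le_sum fun n _ => ?_
        rw [← (h.2 (a n) (b n)).tsum_eq]
        exact norm_tsum_le_tsum_norm (hsum _ _)
    _ = ∑' k, ∑ n ∈ s, ‖(u k : ι → ℂ) (a n) * star ((v k : ι → ℂ) (b n))‖ :=
        (Summable.tsum_finsetSum fun n _ => hsum _ _).symm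
    _ ≤ ∑' k, ‖u k‖ * ‖v k‖ := by
        refine Summable.tsum_le_tsum (fun k => ?_) (summable_sum fun n _ => hsum _ _) h.1
        simp only [norm_mul, norm_star]
        exact sum_norm_mul_norm_le _ _ ha hb s

lemma summable_norm_apply {κ : Type} {X : Matrix ι ι ℂ} (hX : IsTraceClass X) {a b : κ → ι}
    (ha : Function.Injective a) (hb : Function.Injective b) :
    Summable fun n => ‖X (a n) (b n)‖ :=
  summable_of_sum_le (fun _ => norm_nonneg _) (sum_norm_apply_le_traceNorm hX ha hb)

lemma norm_apply_le_traceNorm {X : Matrix ι ι ℂ} (hX : IsTraceClass X) (i j : ι) :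
    ‖X i j‖ ≤ traceNorm X := by
  simpa using sum_norm_apply_le_traceNorm (κ := Unit) hX (a := fun _ => i) (b := fun _ => j)
    (fun _ _ _ => rfl) (fun _ _ _ => rfl) {()}

lemma eq_of_traceNorm_sub_eq_zero {X Y : Matrix ι ι ℂ} (hX : IsTraceClass X) (hY : IsTraceClass Y)
    (h : traceNorm (X - Y) ≤ 0) : X = Y := by
  ext i j
  have := (norm_apply_le_traceNorm (hX.sub hY) i j).trans h
  exact sub_eq_zero.1 (norm_le_zero_iff.1 this)

/-- The finitely supported matrices are dense in the trace class. -/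
lemma exists_finitelySupported_near {X : Matrix ι ι ℂ} (hX : IsTraceClass X) {ε : ℝ} (hε : 0 < ε) :
    ∃ F, IsFinitelySupported F ∧ IsTraceClass F ∧ traceNorm (X - F) < ε := by
  classical
  obtain ⟨u, v, h⟩ := hX
  let P (s : Finset ι) (f : lp (fun _ : ι => ℂ) 2) : lp (fun _ : ι => ℂ) 2 :=
    ∑ i ∈ s, lp.single 2 i (f i)
  have hP (f) : Tendsto (fun s => P s f) atTop (𝓝 f) := lp.hasSum_single (by norm_num) f
  have hPa (s) (f : lp (fun _ : ι => ℂ) 2) (i : ι) : P s f i = if i ∈ s then f i else 0 := by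
    have : (P s f) i = ∑ j ∈ s, (lp.single 2 j (f j) : lp (fun _ : ι => ℂ) 2) i := by
      simp only [P, lp.coeFn_sum, Finset.sum_apply]
    rw [this]
    simp [lp.single_apply, Pi.single_apply]
  have hPn (s) (f : lp (fun _ : ι => ℂ) 2) : ‖P s f‖ ≤ ‖f‖ := by
    have h1 := lp.norm_sum_single (p := 2) (by norm_num) (fun i => f i) s
    have h2 := sum_norm_sq_comp_le f Function.injective_id s
    simp only [ENNReal.toReal_ofNat, Real.rpow_ofNat, id] at h1 h2
    exact (sq_le_sq₀ (norm_nonneg _) (norm_nonneg _)).1 (h1.le.trans h2)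
  have hPc (s) (f : lp (fun _ : ι => ℂ) 2) : ‖f - P s f‖ ≤ 2 * ‖f‖ := by
    linarith [norm_sub_le f (P s f), hPn s f]
  let F (s : Finset ι) : Matrix ι ι ℂ := Matrix.of fun i j => if i ∈ s ∧ j ∈ s then X i j else 0
  have hF (s) : ∀ i j, F s i j ≠ 0 → i ∈ s ∧ j ∈ s := by
    intro i j hij
    by_contra hc
    exact hij (if_neg hc)
  -- With `P` the coordinate projection, `X - PXP = X(1 - P) + (1 - P)XP`. On `|u⟩⟨v|` this is
  -- `|u⟩⟨v - Pv| + |u - Pu⟩⟨Pv|`, whose norms add up to `B`.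
  let B (s : Finset ι) (k : ℕ) : ℝ := ‖u k‖ * ‖v k - P s (v k)‖ + ‖u k - P s (u k)‖ * ‖P s (v k)‖
  have hB (s k) : ‖B s k‖ ≤ 4 * (‖u k‖ * ‖v k‖) := by
    rw [Real.norm_of_nonneg (by positivity)]
    have h1 : ‖u k‖ * ‖v k - P s (v k)‖ ≤ ‖u k‖ * (2 * ‖v k‖) := by gcongr; exact hPc _ _
    have h2 : ‖u k - P s (u k)‖ * ‖P s (v k)‖ ≤ (2 * ‖u k‖) * ‖v k‖ := by
      gcongr
      · exact hPc _ _
      · exact hPn _ _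
    simp only [B]
    linarith
  have hle (s) : traceNorm (X - F s) ≤ ∑' k, B s k := by
    have hBs : Summable (B s) := Summable.of_norm_bounded (h.1.mul_left 4) (hB s)
    have hs1 : Summable fun k => ‖u k‖ * ‖v k - P s (v k)‖ :=
      Summable.of_nonneg_of_le (fun k => by positivity)
        (fun k => le_add_of_nonneg_right (by positivity)) hBs
    have hs2 : Summable fun k => ‖u k - P s (u k)‖ * ‖P s (v k)‖ :=
      Summable.of_nonneg_of_le (fun k => by positivity)
        (fun k => le_add_of_nonneg_left (by positivity)) hBs
    have hs : HasSum (fun k : ℕ ⊕ ℕ => ‖Sum.elim u (fun k => u k - P s (u k)) k‖ *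
        ‖Sum.elim (fun k => v k - P s (v k)) (fun k => P s (v k)) k‖) (∑' k, B s k) := by
      rw [hs1.tsum_add hs2]
      exact HasSum.sum hs1.hasSum hs2.hasSum
    rw [← hs.tsum_eq]
    refine (traceClass_of_hasSum hs.summable fun i j => ?_).2
    have e : (X - F s) i j = (X i j - if j ∈ s then X i j else 0) +
        ((if j ∈ s then X i j else 0) - F s i j) := by simp
    rw [e]
    refine HasSum.sum ?_ ?_
    · by_cases hj : j ∈ s
      · simp [Function.comp_def, hPa, hj]
      · simpa [Function.comp_def, hPa, hj] using h.2 i j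
    · by_cases hj : j ∈ s
      · by_cases hi : i ∈ s
        · simp [Function.comp_def, hPa, hj, hi, F]
        · simpa [Function.comp_def, hPa, hj, hi, F] using h.2 i j
      · simp [Function.comp_def, hPa, hj, F]
  -- Dominated convergence in `k`: each term tends to zero as `P` tends strongly to the identity,
  -- and `4 ‖u k‖ ‖v k‖` dominates.
  have hlim : Tendsto (fun s => ∑' k, B s k) atTop (𝓝 (∑' _ : ℕ, (0 : ℝ))) := by
    refine tendsto_tsum_of_dominated_convergence (h.1.mul_left 4) (fun k => ?_)
      (Eventually.of_forall hB)
    have h1 : Tendsto (fun s => ‖v k - P s (v k)‖) atTop (𝓝 0) := by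
      simpa using ((tendsto_const_nhds (x := v k)).sub (hP (v k))).norm
    have h2 : Tendsto (fun s => ‖u k - P s (u k)‖) atTop (𝓝 0) := by
      simpa using ((tendsto_const_nhds (x := u k)).sub (hP (u k))).norm
    simpa using (h1.const_mul ‖u k‖).add (h2.mul (hP (v k)).norm)
  rw [tsum_zero] at hlim
  obtain ⟨s, hs⟩ := (hlim.eventually (gt_mem_nhds hε)).exists
  exact ⟨F s, isFinitelySupported_of_support (hF s), (traceClass_of_support (hF s)).1,
    (hle s).trans_lt hs⟩

end TraceClass

/-! ### The explicit semigroup of a damped mode -/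

lemma hasSum_of_forall_eq {α E : Type} [AddCommMonoid E] [TopologicalSpace E] {f g : α → E} {a : E}
    (hg : HasSum g a) (h : ∀ b, f b = g b) : HasSum f a := by
  rwa [funext h]

/-- Absolute convergence permits grouping a double series by the total `p.1 + p.2`. -/
lemma hasSum_of_summable_antidiagonal {E : Type} [NormedAddCommGroup E] [CompleteSpace E]
    {F : ℕ × ℕ → E} (h : Summable fun n => ∑ p ∈ Finset.HasAntidiagonal.antidiagonal n, ‖F p‖) :
    HasSum F (∑' n, ∑ p ∈ Finset.HasAntidiagonal.antidiagonal n, F p) := by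
  let e := Finset.HasAntidiagonal.sigmaAntidiagonalEquivProd (A := ℕ)
  have hs : Summable fun x => ‖(F ∘ e) x‖ := by
    refine (summable_sigma_of_nonneg fun _ => norm_nonneg _).2
      ⟨fun n => (hasSum_fintype _).summable, ?_⟩
    convert h using 2 with n
    rw [tsum_fintype]
    exact Finset.sum_coe_sort (Finset.HasAntidiagonal.antidiagonal n) fun p => ‖F p‖
  have hs' : Summable (F ∘ e) := hs.of_norm
  rw [← e.hasSum_iff]
  convert hs'.hasSum using 1
  rw [hs'.tsum_sigma' fun n => (hasSum_fintype _).summable]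
  congr 1 with n
  rw [tsum_fintype]
  exact (Finset.sum_coe_sort (Finset.HasAntidiagonal.antidiagonal n) fun p => F p).symm

/-- Summation of the binomial theorem against a sequence. -/
lemma hasSum_choose_mul {𝕜 : Type} [RCLike 𝕜] {x y : ℝ} (hx : 0 ≤ x) (hy : 0 ≤ y) {G : ℕ → 𝕜}
    (hG : Summable fun n => (x + y) ^ n * ‖G n‖) :
    HasSum (fun p : ℕ × ℕ => ((Nat.choose (p.1 + p.2) p.1 * x ^ p.1 * y ^ p.2 : ℝ) : 𝕜) *
      G (p.1 + p.2)) (∑' n, (((x + y) ^ n : ℝ) : 𝕜) * G n) := by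
  have hsum (n : ℕ) : ∑ p ∈ Finset.HasAntidiagonal.antidiagonal n,
      (Nat.choose (p.1 + p.2) p.1 * x ^ p.1 * y ^ p.2 : ℝ) = (x + y) ^ n := by
    rw [add_pow, Finset.Nat.sum_antidiagonal_eq_sum_range_succ_mk]
    refine Finset.sum_congr rfl fun k hk => ?_
    have : k + (n - k) = n := by have := Finset.mem_range.1 hk; omega
    simp only [this]
    ring
  have h := hasSum_of_summable_antidiagonal (F := fun p : ℕ × ℕ =>
    ((Nat.choose (p.1 + p.2) p.1 * x ^ p.1 * y ^ p.2 : ℝ) : 𝕜) * G (p.1 + p.2)) ?_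
  · have e (n : ℕ) : (((x + y) ^ n : ℝ) : 𝕜) * G n =
        ∑ p ∈ Finset.HasAntidiagonal.antidiagonal n,
          ((Nat.choose (p.1 + p.2) p.1 * x ^ p.1 * y ^ p.2 : ℝ) : 𝕜) * G (p.1 + p.2) := by
      rw [← hsum n, RCLike.ofReal_sum, Finset.sum_mul]
      refine Finset.sum_congr rfl fun p hp => ?_
      rw [Finset.HasAntidiagonal.mem_antidiagonal.1 hp]
    rw [tsum_congr e]
    exact h
  · convert hG using 2 with n
    rw [← hsum n, Finset.sum_mul]
    refine Finset.sum_congr rfl fun p hp => ?_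
    rw [norm_mul, Finset.HasAntidiagonal.mem_antidiagonal.1 hp, RCLike.norm_ofReal, abs_of_nonneg (by positivity)]

/-- Addition of `k` photons. -/
def shift (k : ℕ) (i : Fin 2 × ℕ) : Fin 2 × ℕ := (i.1, i.2 + k)

lemma shift_injective (i : Fin 2 × ℕ) : Function.Injective fun k => shift k i := by
  intro k l h
  simpa [shift] using h

lemma shift_shift (k l : ℕ) (i : Fin 2 × ℕ) : shift l (shift k i) = shift (k + l) i := by
  simp [shift, add_assoc]

lemma shift_zero (i : Fin 2 × ℕ) : shift 0 i = i := rfl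

/-- The loss probability `1 - e^{-γt}` of a photon. -/
noncomputable def lossProb (γ t : ℝ) : ℝ := 1 - Real.exp (-γ * t)

/-- The complex frequency `i E + γ n / 2` of a product basis vector. -/
noncomputable def decayRate (ωA ωc γ : ℝ) (i : Fin 2 × ℕ) : ℂ :=
  Complex.I * (ωA * (i.1 : ℕ) + ωc * i.2) + γ / 2 * i.2

/-- The nonzero entry in row `i` of the Kraus operator that describes the loss of `k` photons. -/
noncomputable def kraus (ωA ωc γ t : ℝ) (k : ℕ) (i : Fin 2 × ℕ) : ℂ :=
  Complex.exp (-decayRate ωA ωc γ i * t) *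
    (√((i.2 + k).choose k * lossProb γ t ^ k) : ℝ)

/-- The semigroup `e^{𝓛₀ t}` in Kraus form. -/
noncomputable def freeEvolution (ωA ωc γ t : ℝ) (X : JointOp) : JointOp := Matrix.of fun i j =>
  ∑' k, kraus ωA ωc γ t k i * X (shift k i) (shift k j) * star (kraus ωA ωc γ t k j)

variable {ωA ωc γ : ℝ}

lemma lossProb_zero : lossProb γ 0 = 0 := by simp [lossProb]

lemma lossProb_nonneg (hγ : 0 ≤ γ) {t : ℝ} (ht : 0 ≤ t) : 0 ≤ lossProb γ t := by
  have : Real.exp (-γ * t) ≤ 1 := Real.exp_le_one_iff.2 (by nlinarith)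
  unfold lossProb
  linarith

lemma exp_add_lossProb (t : ℝ) : Real.exp (-γ * t) + lossProb γ t = 1 := by
  simp [lossProb]

/-- This is the binomial probability that exactly `k` of `k + i.2` photons are lost; the phases
disappear from the modulus. -/
lemma norm_kraus_sq (hγ : 0 ≤ γ) {t : ℝ} (ht : 0 ≤ t) (k : ℕ) (i : Fin 2 × ℕ) :
    ‖kraus ωA ωc γ t k i‖ ^ 2 =
      (k + i.2).choose k * lossProb γ t ^ k * Real.exp (-γ * t) ^ i.2 := by
  have hq := lossProb_nonneg hγ ht
  rw [kraus, norm_mul, mul_pow, Complex.norm_exp, Complex.norm_real, Real.norm_eq_abs, sq_abs,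
    Real.sq_sqrt (by positivity), ← Real.exp_nat_mul, ← Real.exp_nat_mul, add_comm i.2 k, mul_comm]
  congr 2
  simp [decayRate]
  ring

/-- The square is one term of the binomial expansion of `(q + e^{-γt})^(k + i.2) = 1`. -/
lemma norm_kraus_le_one (hγ : 0 ≤ γ) {t : ℝ} (ht : 0 ≤ t) (k : ℕ) (i : Fin 2 × ℕ) :
    ‖kraus ωA ωc γ t k i‖ ≤ 1 := by
  have hq := lossProb_nonneg hγ ht
  rw [← sq_le_one_iff₀ (norm_nonneg _), norm_kraus_sq hγ ht]
  have h := add_pow (lossProb γ t) (Real.exp (-γ * t)) (k + i.2)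
  rw [add_comm (lossProb γ t), exp_add_lossProb, one_pow] at h
  rw [h]
  have := Finset.single_le_sum (f := fun m => lossProb γ t ^ m * Real.exp (-γ * t) ^ (k + i.2 - m) *
    ((k + i.2).choose m : ℝ)) (s := Finset.range (k + i.2 + 1)) (fun m _ => by positivity)
    (Finset.mem_range.2 (by omega : k < k + i.2 + 1))
  refine le_trans (le_of_eq ?_) this
  simp only [Nat.add_sub_cancel_left]
  ring

lemma kraus_mul_star (hγ : 0 ≤ γ) {t : ℝ} (ht : 0 ≤ t) (k : ℕ) (i j : Fin 2 × ℕ) :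
    kraus ωA ωc γ t k i * star (kraus ωA ωc γ t k j) =
      Complex.exp (-(decayRate ωA ωc γ i + star (decayRate ωA ωc γ j)) * t) *
        (√((i.2 + k).choose k) * √((j.2 + k).choose k) * lossProb γ t ^ k : ℝ) := by
  have hq := lossProb_nonneg hγ ht
  have h1 : √((i.2 + k).choose k * lossProb γ t ^ k) * √((j.2 + k).choose k * lossProb γ t ^ k) =
      √((i.2 + k).choose k) * √((j.2 + k).choose k) * lossProb γ t ^ k := by
    rw [Real.sqrt_mul (by positivity), Real.sqrt_mul (by positivity)]
    have := Real.mul_self_sqrt (pow_nonneg hq k)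
    linear_combination (√((i.2 + k).choose k) * √((j.2 + k).choose k)) * this
  rw [← h1, kraus, kraus, neg_add, add_mul, Complex.exp_add]
  simp only [RCLike.star_def, map_mul, ← Complex.exp_conj, map_neg, Complex.conj_ofReal,
    Complex.ofReal_mul]
  ring

/-- This is `∑ₖ Kₖ† Kₖ = 1` as an identity of norms: for each initial photon number, the
probabilities of all numbers of losses sum to one. -/
lemma hasSum_norm_kraus_mul_sq (hγ : 0 ≤ γ) {t : ℝ} (ht : 0 ≤ t)
    (u : lp (fun _ : Fin 2 × ℕ => ℂ) 2) :
    HasSum (fun p : ℕ × (Fin 2 × ℕ) => ‖kraus ωA ωc γ t p.1 p.2 * u (shift p.1 p.2)‖ ^ 2)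
      (‖u‖ ^ 2) := by
  have hu := hasSum_norm_sq u
  have hua (a : Fin 2) : Summable fun n => ‖u (a, n)‖ ^ 2 :=
    hu.summable.comp_injective (Prod.mk_right_injective a)
  have hfib (a : Fin 2) : HasSum (fun p : ℕ × ℕ => ‖kraus ωA ωc γ t p.1 (a, p.2) *
      u (shift p.1 (a, p.2))‖ ^ 2) (∑' n, ‖u (a, n)‖ ^ 2) := by
    have h := hasSum_choose_mul (𝕜 := ℝ) (G := fun n => ‖u (a, n)‖ ^ 2) (lossProb_nonneg hγ ht)
      (Real.exp_nonneg (-γ * t)) (by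
        simpa only [add_comm (lossProb γ t), exp_add_lossProb, one_pow, one_mul, norm_pow,
          norm_norm] using hua a)
    simp only [add_comm (lossProb γ t), exp_add_lossProb, one_pow, RCLike.ofReal_real_eq_id, id,
      one_mul] at h
    refine hasSum_of_forall_eq h fun p => ?_
    rw [norm_mul, mul_pow, norm_kraus_sq hγ ht, shift, add_comm p.2]
  have hsum : Summable fun p : Fin 2 × (ℕ × ℕ) => ‖kraus ωA ωc γ t p.2.1 (p.1, p.2.2) *
      u (shift p.2.1 (p.1, p.2.2))‖ ^ 2 :=
    (summable_prod_of_nonneg fun _ => by positivity).2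
      ⟨fun a => (hfib a).summable, (hasSum_fintype _).summable⟩
  have htot : HasSum (fun p : Fin 2 × (ℕ × ℕ) => ‖kraus ωA ωc γ t p.2.1 (p.1, p.2.2) *
      u (shift p.2.1 (p.1, p.2.2))‖ ^ 2) (‖u‖ ^ 2) := by
    have e := (HasSum.prod_fiberwise hu fun a => (hua a).hasSum).unique (hasSum_fintype _)
    rw [e]
    convert hsum.hasSum using 1
    rw [hsum.tsum_prod' fun a => (hfib a).summable, tsum_fintype]
    exact Finset.sum_congr rfl fun a _ => (hfib a).tsum_eq.symm
  let e : ℕ × (Fin 2 × ℕ) ≃ Fin 2 × (ℕ × ℕ) :=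
    ⟨fun p => (p.2.1, p.1, p.2.2), fun p => (p.2.1, p.1, p.2.2), fun _ => rfl, fun _ => rfl⟩
  exact (e.hasSum_iff).2 htot

lemma exists_lp_eq {ι : Type} {f : ι → ℂ} (h : Summable fun i => ‖f i‖ ^ 2) :
    ∃ w : lp (fun _ : ι => ℂ) 2, (w : ι → ℂ) = f :=
  ⟨⟨f, memℓp_two_iff.2 h⟩, rfl⟩

lemma exists_kraus_apply (hγ : 0 ≤ γ) {t : ℝ} (ht : 0 ≤ t) (u : lp (fun _ : Fin 2 × ℕ => ℂ) 2) :
    ∃ w : ℕ → lp (fun _ : Fin 2 × ℕ => ℂ) 2,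
      (∀ k i, (w k : Fin 2 × ℕ → ℂ) i = kraus ωA ωc γ t k i * u (shift k i)) ∧
      HasSum (fun k => ‖w k‖ ^ 2) (‖u‖ ^ 2) := by
  have h := hasSum_norm_kraus_mul_sq (ωA := ωA) (ωc := ωc) hγ ht u
  have hk (k : ℕ) : Summable fun i => ‖kraus ωA ωc γ t k i * u (shift k i)‖ ^ 2 :=
    h.summable.prod_factor k
  choose w hw using fun k => exists_lp_eq (hk k)
  have hw' (k : ℕ) (i : Fin 2 × ℕ) : (w k : Fin 2 × ℕ → ℂ) i =
      kraus ωA ωc γ t k i * u (shift k i) := by rw [hw k]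
  refine ⟨w, hw', HasSum.prod_fiberwise (g := fun k => ‖w k‖ ^ 2) h fun k => ?_⟩
  exact hasSum_of_forall_eq (hasSum_norm_sq (w k)) fun i => by rw [hw' k]

lemma summable_freeEvolution (hγ : 0 ≤ γ) {t : ℝ} (ht : 0 ≤ t) {X : JointOp} (hX : IsTraceClass X)
    (i j : Fin 2 × ℕ) : Summable fun k =>
      ‖kraus ωA ωc γ t k i * X (shift k i) (shift k j) * star (kraus ωA ωc γ t k j)‖ := by
  refine Summable.of_nonneg_of_le (fun _ => norm_nonneg _) (fun k => ?_)
    (summable_norm_apply hX (shift_injective i) (shift_injective j))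
  rw [norm_mul, norm_mul, norm_star]
  calc _ ≤ 1 * ‖X (shift k i) (shift k j)‖ * 1 := by
        gcongr <;> exact norm_kraus_le_one hγ ht _ _
    _ = _ := by ring

/-- Applying the Kraus operators to `|u⟩⟨v|` gives the terms `|Kₖ u⟩⟨Kₖ v|`. Cauchy–Schwarz in `k`
with `∑ₖ ‖Kₖ u‖² = ‖u‖²` bounds the sum of their norms by `‖u‖ ‖v‖`, so every nuclear representation
is carried to one that costs no more. -/
lemma freeEvolution_traceClass_and_le (hγ : 0 ≤ γ) {t : ℝ} (ht : 0 ≤ t) {X : JointOp}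
    (hX : IsTraceClass X) : IsTraceClass (freeEvolution ωA ωc γ t X) ∧
      traceNorm (freeEvolution ωA ωc γ t X) ≤ traceNorm X := by
  have main : ∀ u v, IsNuclearRep X u v → IsTraceClass (freeEvolution ωA ωc γ t X) ∧
      traceNorm (freeEvolution ωA ωc γ t X) ≤ ∑' n, ‖u n‖ * ‖v n‖ := by
    intro u v h
    choose w hw hw2 using fun n => exists_kraus_apply (ωA := ωA) (ωc := ωc) hγ ht (u n)
    choose w' hw' hw2' using fun n => exists_kraus_apply (ωA := ωA) (ωc := ωc) hγ ht (v n)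
    have hfin (n : ℕ) (s : Finset ℕ) : ∑ k ∈ s, ‖w n k‖ * ‖w' n k‖ ≤ ‖u n‖ * ‖v n‖ := by
      refine (Real.sum_mul_le_sqrt_mul_sqrt s _ _).trans ?_
      gcongr
      · exact Real.sqrt_le_iff.2 ⟨norm_nonneg _, sum_le_hasSum _ (fun _ _ => sq_nonneg _) (hw2 n)⟩
      · exact Real.sqrt_le_iff.2 ⟨norm_nonneg _, sum_le_hasSum _ (fun _ _ => sq_nonneg _) (hw2' n)⟩
    have hfib (n : ℕ) : Summable fun k => ‖w n k‖ * ‖w' n k‖ :=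
      summable_of_sum_le (fun _ => by positivity) (hfin n)
    have hle (n : ℕ) : ∑' k, ‖w n k‖ * ‖w' n k‖ ≤ ‖u n‖ * ‖v n‖ :=
      (hfib n).tsum_le_of_sum_le (hfin n)
    have hs1 : Summable fun n => ∑' k, ‖w n k‖ * ‖w' n k‖ :=
      Summable.of_nonneg_of_le (fun n => tsum_nonneg fun k => by positivity) hle h.1
    have hs : Summable fun p : ℕ × ℕ => ‖w p.1 p.2‖ * ‖w' p.1 p.2‖ :=
      (summable_prod_of_nonneg fun _ => by positivity).2 ⟨hfib, hs1⟩
    have hbound : ∑' p : ℕ × ℕ, ‖w p.1 p.2‖ * ‖w' p.1 p.2‖ ≤ ∑' n, ‖u n‖ * ‖v n‖ := by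
      rw [hs.tsum_prod' hfib]
      exact hs1.tsum_le_tsum hle h.1
    have hmain := traceClass_of_hasSum (X := freeEvolution ωA ωc γ t X) hs fun i j => by
      have hf : Summable fun p : ℕ × ℕ => (w p.1 p.2 : Fin 2 × ℕ → ℂ) i *
          star ((w' p.1 p.2 : Fin 2 × ℕ → ℂ) j) := by
        refine Summable.of_norm_bounded hs fun p => ?_
        rw [norm_mul, norm_star]
        gcongr <;> exact lp.norm_apply_le_norm (by norm_num) _ _
      have hk (k : ℕ) : HasSum (fun n => (w n k : Fin 2 × ℕ → ℂ) i *
          star ((w' n k : Fin 2 × ℕ → ℂ) j))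
          (kraus ωA ωc γ t k i * X (shift k i) (shift k j) * star (kraus ωA ωc γ t k j)) := by
        refine hasSum_of_forall_eq (((h.2 (shift k i) (shift k j)).mul_left
          (kraus ωA ωc γ t k i)).mul_right (star (kraus ωA ωc γ t k j))) fun n => ?_
        rw [hw, hw', star_mul']
        ring
      convert hf.hasSum using 1
      have hf' := (Equiv.prodComm ℕ ℕ).summable_iff.2 hf
      rw [← (Equiv.prodComm ℕ ℕ).tsum_eq]
      refine Eq.trans ?_ (hf'.tsum_prod' fun k => (hk k).summable).symm
      exact tsum_congr fun k => (hk k).tsum_eq.symm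
    exact ⟨hmain.1, hmain.2.trans hbound⟩
  constructor
  · obtain ⟨u, v, h⟩ := hX
    exact (main u v h).1
  · exact le_traceNorm hX fun u v h => (main u v h).2

lemma IsTraceClass.freeEvolution (hγ : 0 ≤ γ) {t : ℝ} (ht : 0 ≤ t) {X : JointOp}
    (hX : IsTraceClass X) : IsTraceClass (freeEvolution ωA ωc γ t X) :=
  (freeEvolution_traceClass_and_le hγ ht hX).1

lemma traceNorm_freeEvolution_le (hγ : 0 ≤ γ) {t : ℝ} (ht : 0 ≤ t) {X : JointOp}
    (hX : IsTraceClass X) : traceNorm (freeEvolution ωA ωc γ t X) ≤ traceNorm X :=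
  (freeEvolution_traceClass_and_le hγ ht hX).2

lemma freeEvolution_add (hγ : 0 ≤ γ) {t : ℝ} (ht : 0 ≤ t) {X Y : JointOp} (hX : IsTraceClass X)
    (hY : IsTraceClass Y) : freeEvolution ωA ωc γ t (X + Y) =
      freeEvolution ωA ωc γ t X + freeEvolution ωA ωc γ t Y := by
  ext i j
  simp only [freeEvolution, Matrix.of_apply, Matrix.add_apply, mul_add, add_mul]
  exact (summable_freeEvolution hγ ht hX i j).of_norm.tsum_add
    (summable_freeEvolution hγ ht hY i j).of_norm

lemma freeEvolution_smul (t : ℝ) (c : ℂ) (X : JointOp) :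
    freeEvolution ωA ωc γ t (c • X) = c • freeEvolution ωA ωc γ t X := by
  ext i j
  simp only [freeEvolution, Matrix.of_apply, Matrix.smul_apply, smul_eq_mul]
  rw [← tsum_mul_left]
  exact tsum_congr fun k => by ring

lemma freeEvolution_sub (hγ : 0 ≤ γ) {t : ℝ} (ht : 0 ≤ t) {X Y : JointOp} (hX : IsTraceClass X)
    (hY : IsTraceClass Y) : freeEvolution ωA ωc γ t (X - Y) =
      freeEvolution ωA ωc γ t X - freeEvolution ωA ωc γ t Y := by
  have := freeEvolution_add (ωA := ωA) (ωc := ωc) hγ ht (hX.sub hY) hY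
  rw [sub_add_cancel] at this
  rw [this, add_sub_cancel_right]

lemma freeEvolution_zero (X : JointOp) : freeEvolution ωA ωc γ 0 X = X := by
  ext i j
  simp only [freeEvolution, Matrix.of_apply]
  rw [tsum_eq_single 0]
  · simp [kraus, shift_zero]
  · intro k hk
    simp [kraus, lossProb_zero, hk]

lemma choose_mul_choose (m k l : ℕ) : (m + k).choose k * (m + k + l).choose l =
    (m + (k + l)).choose (k + l) * (k + l).choose k := by
  have h := Nat.choose_mul (n := m + (k + l)) (k := k + l) (s := l) (by omega)
  rw [show m + (k + l) - l = m + k by omega, show k + l - l = k by omega] at h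
  rw [show (k + l).choose k = (k + l).choose l from Nat.choose_symm_add, h,
    show m + k + l = m + (k + l) by omega]
  ring

/-- Losing `l` photons during `r` and `k` more during the later time `s` amounts to losing `k + l`
in all. The `k` late ones must first survive, hence their weight `e^{-γr} q(s)`; the factor `(k +
l).choose k` counts the ways to split the losses. -/
lemma kraus_mul_kraus (hγ : 0 ≤ γ) {s r : ℝ} (hs : 0 ≤ s) (hr : 0 ≤ r) (k l : ℕ)
    (i j : Fin 2 × ℕ) :
    (kraus ωA ωc γ s k i * star (kraus ωA ωc γ s k j)) *
      (kraus ωA ωc γ r l (shift k i) * star (kraus ωA ωc γ r l (shift k j))) =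
    ((((k + l).choose k * (Real.exp (-γ * r) * lossProb γ s) ^ k * lossProb γ r ^ l : ℝ)) : ℂ) *
      (Complex.exp (-(decayRate ωA ωc γ i + star (decayRate ωA ωc γ j)) * (s + r : ℝ)) *
        (√((i.2 + (k + l)).choose (k + l)) * √((j.2 + (k + l)).choose (k + l)) : ℝ)) := by
  have h1 (m : ℕ) : √((m + k).choose k) * √((m + k + l).choose l) =
      √((m + (k + l)).choose (k + l)) * √((k + l).choose k) := by
    rw [← Real.sqrt_mul (by positivity), ← Real.sqrt_mul (by positivity)]
    exact_mod_cast congrArg (fun n : ℕ => √(n : ℝ)) (choose_mul_choose m k l)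
  have h2 := Real.mul_self_sqrt (Nat.cast_nonneg (α := ℝ) ((k + l).choose k))
  have h3 : √((i.2 + k).choose k) * √((j.2 + k).choose k) *
      (√((i.2 + k + l).choose l) * √((j.2 + k + l).choose l)) =
      ((k + l).choose k : ℝ) *
        (√((i.2 + (k + l)).choose (k + l)) * √((j.2 + (k + l)).choose (k + l))) := by
    linear_combination √((j.2 + k).choose k) * √((j.2 + k + l).choose l) * h1 i.2 +
      √((i.2 + (k + l)).choose (k + l)) * √((k + l).choose k) * h1 j.2 +
      √((i.2 + (k + l)).choose (k + l)) * √((j.2 + (k + l)).choose (k + l)) * h2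
  -- The row `shift k i` carries `k` extra photons: in the product with the conjugate their phases
  -- cancel and only the damping `e^{-γrk}` remains.
  have h4 : Complex.exp (-(decayRate ωA ωc γ (shift k i) +
      star (decayRate ωA ωc γ (shift k j))) * r) =
      Complex.exp (-(decayRate ωA ωc γ i + star (decayRate ωA ωc γ j)) * r) *
        ((Real.exp (-γ * r) ^ k : ℝ) : ℂ) := by
    rw [← Real.exp_nat_mul, Complex.ofReal_exp, ← Complex.exp_add]
    congr 1
    simp [decayRate, shift]
    ring
  rw [kraus_mul_star hγ hs, kraus_mul_star hγ hr, h4]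
  have h5 : Complex.exp (-(decayRate ωA ωc γ i + star (decayRate ωA ωc γ j)) * (s + r : ℝ)) =
      Complex.exp (-(decayRate ωA ωc γ i + star (decayRate ωA ωc γ j)) * s) *
        Complex.exp (-(decayRate ωA ωc γ i + star (decayRate ωA ωc γ j)) * r) := by
    rw [← Complex.exp_add]; push_cast; ring_nf
  rw [h5]
  have h3' := congrArg (fun x : ℝ => (x : ℂ)) h3
  simp only [Complex.ofReal_mul, shift, mul_pow, Complex.ofReal_pow, Complex.ofReal_natCast]
    at h3' ⊢
  linear_combination (Complex.exp (-(decayRate ωA ωc γ i + star (decayRate ωA ωc γ j)) * s) *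
        Complex.exp (-(decayRate ωA ωc γ i + star (decayRate ωA ωc γ j)) * r) *
        (Real.exp (-γ * r) : ℂ) ^ k * (lossProb γ s : ℂ) ^ k * (lossProb γ r : ℂ) ^ l) * h3'

lemma freeEvolution_freeEvolution (hγ : 0 ≤ γ) {s r : ℝ} (hs : 0 ≤ s) (hr : 0 ≤ r) {X : JointOp}
    (hX : IsTraceClass X) : freeEvolution ωA ωc γ (s + r) X =
      freeEvolution ωA ωc γ s (freeEvolution ωA ωc γ r X) := by
  ext i j
  let G (n : ℕ) : ℂ := Complex.exp (-(decayRate ωA ωc γ i + star (decayRate ωA ωc γ j)) *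
    (s + r : ℝ)) * (√((i.2 + n).choose n) * √((j.2 + n).choose n) : ℝ) * X (shift n i) (shift n j)
  -- A photon is lost in time `s + r` either during `r`, or by surviving `r` and being lost during
  -- `s`. This lets the binomial theorem produce `lossProb γ (s + r) ^ n`.
  have hq : Real.exp (-γ * r) * lossProb γ s + lossProb γ r = lossProb γ (s + r) := by
    have : Real.exp (-γ * (s + r)) = Real.exp (-γ * s) * Real.exp (-γ * r) := by
      rw [← Real.exp_add]; ring_nf
    simp only [lossProb, this]
    ring
  have hG (n : ℕ) : ((lossProb γ (s + r) ^ n : ℝ) : ℂ) * G n =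
      kraus ωA ωc γ (s + r) n i * X (shift n i) (shift n j) *
        star (kraus ωA ωc γ (s + r) n j) := by
    rw [mul_right_comm (kraus _ _ _ _ _ _), kraus_mul_star hγ (add_nonneg hs hr)]
    simp only [G, Complex.ofReal_mul, Complex.ofReal_pow]
    ring
  have h := hasSum_choose_mul (G := G)
    (mul_nonneg (Real.exp_nonneg (-γ * r)) (lossProb_nonneg hγ hs)) (lossProb_nonneg hγ hr) (by
      rw [hq]
      refine (summable_congr fun n => ?_).2
        (summable_freeEvolution (ωA := ωA) (ωc := ωc) hγ (add_nonneg hs hr) hX i j)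
      rw [← hG, norm_mul _ (G n), Complex.norm_real,
        Real.norm_of_nonneg (pow_nonneg (lossProb_nonneg hγ (add_nonneg hs hr)) n)])
  rw [hq] at h
  have hterm (p : ℕ × ℕ) : ((((p.1 + p.2).choose p.1 * (Real.exp (-γ * r) * lossProb γ s) ^ p.1 *
      lossProb γ r ^ p.2 : ℝ)) : ℂ) * G (p.1 + p.2) = kraus ωA ωc γ s p.1 i *
      (kraus ωA ωc γ r p.2 (shift p.1 i) * X (shift p.2 (shift p.1 i)) (shift p.2 (shift p.1 j)) *
        star (kraus ωA ωc γ r p.2 (shift p.1 j))) * star (kraus ωA ωc γ s p.1 j) := by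
    have := kraus_mul_kraus (ωA := ωA) (ωc := ωc) hγ hs hr p.1 p.2 i j
    rw [shift_shift, shift_shift]
    simp only [G]
    linear_combination -X (shift (p.1 + p.2) i) (shift (p.1 + p.2) j) * this
  have h' := HasSum.prod_fiberwise h (g := fun k => kraus ωA ωc γ s k i *
    freeEvolution ωA ωc γ r X (shift k i) (shift k j) * star (kraus ωA ωc γ s k j)) fun k => by
      have hk := ((summable_freeEvolution (ωA := ωA) (ωc := ωc) hγ hr hX (shift k i)
        (shift k j)).of_norm.hasSum.mul_left (kraus ωA ωc γ s k i)).mul_right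
          (star (kraus ωA ωc γ s k j))
      exact hasSum_of_forall_eq hk fun l => hterm (k, l)
  refine Eq.trans ?_ h'.tsum_eq.symm
  exact tsum_congr fun n => (hG n).symm

/-! ### Matrix elements of the generators -/

lemma diagonal_opMul {ι : Type} [DecidableEq ι] (d : ι → ℂ) (X : Matrix ι ι ℂ) (i j : ι) :
    (Matrix.diagonal d ⋄ X) i j = d i * X i j := by
  rw [opMul, Matrix.of_apply, tsum_eq_single i, Matrix.diagonal_apply_eq]
  intro k hk
  rw [Matrix.diagonal_apply_ne' _ hk, zero_mul]

lemma opMul_diagonal {ι : Type} [DecidableEq ι] (d : ι → ℂ) (X : Matrix ι ι ℂ) (i j : ι) :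
    (X ⋄ Matrix.diagonal d) i j = X i j * d j := by
  rw [opMul, Matrix.of_apply, tsum_eq_single j, Matrix.diagonal_apply_eq]
  intro k hk
  rw [Matrix.diagonal_apply_ne _ hk, mul_zero]

lemma creation_apply (m n : ℕ) :
    creation m n = if m = n + 1 then ((Real.sqrt m : ℝ) : ℂ) else 0 := by
  simp only [creation, Matrix.conjTranspose_apply, annihilation, Matrix.of_apply]
  split_ifs <;> simp

lemma annihilation_apply (m n : ℕ) :
    annihilation m n = if n = m + 1 then ((Real.sqrt n : ℝ) : ℂ) else 0 := rfl

lemma creation_opMul_annihilation :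
    creation ⋄ annihilation = Matrix.diagonal fun n : ℕ => (n : ℂ) := by
  ext m n
  rw [opMul, Matrix.of_apply]
  cases m with
  | zero =>
    rw [(tsum_congr fun k => by simp [creation_apply]).trans tsum_zero]
    by_cases hn : 0 = n
    · subst hn; simp
    · simp [Matrix.diagonal_apply_ne _ hn]
  | succ m =>
    rw [tsum_eq_single m]
    · by_cases hn : n = m + 1
      · subst hn
        rw [creation_apply, annihilation_apply, if_pos rfl, Matrix.diagonal_apply_eq,
          ← Complex.ofReal_mul, Real.mul_self_sqrt (by positivity)]
        simp
      · rw [annihilation_apply, if_neg hn, mul_zero, Matrix.diagonal_apply_ne' _ hn]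
    · intro k hk
      rw [creation_apply, if_neg (by omega), zero_mul]

lemma one_kronecker_number :
    (1 : AtomOp) ⊗ₖ (creation ⋄ annihilation) =
      Matrix.diagonal fun i : Fin 2 × ℕ => (i.2 : ℂ) := by
  rw [creation_opMul_annihilation, ← Matrix.diagonal_one, Matrix.diagonal_kronecker_diagonal]
  simp

lemma freeHamiltonian_eq (ωA ωc : ℝ) : freeHamiltonian ωA ωc =
    Matrix.diagonal fun i : Fin 2 × ℕ => (ωA * (i.1 : ℕ) + ωc * i.2 : ℂ) := by
  have h : sigmaPlus * sigmaMinus = Matrix.diagonal fun a : Fin 2 => ((a : ℕ) : ℂ) := by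
    ext a b
    fin_cases a <;> fin_cases b <;> simp [sigmaPlus, sigmaMinus]
  rw [freeHamiltonian, one_kronecker_number, h, ← Matrix.diagonal_one,
    Matrix.diagonal_kronecker_diagonal, ← Matrix.diagonal_smul, ← Matrix.diagonal_smul,
    Matrix.diagonal_add]
  simp

lemma one_kronecker_annihilation_opMul (X : JointOp) (i j : Fin 2 × ℕ) :
    ((1 : AtomOp) ⊗ₖ annihilation ⋄ X) i j = (√(i.2 + 1) : ℝ) * X (shift 1 i) j := by
  rw [opMul, Matrix.of_apply, tsum_eq_single (shift 1 i)]
  · simp [shift, annihilation_apply, Matrix.kroneckerMap_apply]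
  · rintro ⟨a, n⟩ hk
    by_cases ha : i.1 = a
    · have : n ≠ i.2 + 1 := by
        rintro rfl
        exact hk (by simp [shift, ha])
      simp [Matrix.kroneckerMap_apply, annihilation_apply, this]
    · simp [Matrix.kroneckerMap_apply, Matrix.one_apply_ne ha]

lemma opMul_one_kronecker_creation (X : JointOp) (i j : Fin 2 × ℕ) :
    (X ⋄ ((1 : AtomOp) ⊗ₖ creation)) i j = X i (shift 1 j) * (√(j.2 + 1) : ℝ) := by
  rw [opMul, Matrix.of_apply, tsum_eq_single (shift 1 j)]
  · simp [shift, creation_apply, Matrix.kroneckerMap_apply]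
  · rintro ⟨a, n⟩ hk
    by_cases ha : a = j.1
    · have : n ≠ j.2 + 1 := by
        rintro rfl
        exact hk (by simp [shift, ha])
      simp [Matrix.kroneckerMap_apply, creation_apply, this]
    · simp [Matrix.kroneckerMap_apply, Matrix.one_apply_ne ha]

/-- Each entry decays at its own complex rate and is fed only by the entry with one more photon on
both sides; this triangular form is what the first two Kraus terms reproduce at time zero. -/
lemma freeGenerator_apply (ωA ωc γ : ℝ) (X : JointOp) (i j : Fin 2 × ℕ) :
    freeGenerator ωA ωc γ X i j =
      -(decayRate ωA ωc γ i + star (decayRate ωA ωc γ j)) * X i j +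
        γ * (√(i.2 + 1) * √(j.2 + 1) : ℝ) * X (shift 1 i) (shift 1 j) := by
  rw [freeGenerator, dissipator, freeHamiltonian_eq, one_kronecker_number]
  simp only [Matrix.add_apply, Matrix.smul_apply, Matrix.sub_apply, diagonal_opMul, opMul_diagonal,
    opMul_one_kronecker_creation, one_kronecker_annihilation_opMul, smul_eq_mul, decayRate,
    RCLike.star_def, map_add, map_mul, map_div₀, Complex.conj_I, Complex.conj_ofReal, map_natCast,
    map_ofNat, Complex.ofReal_mul]
  ring

/-! ### Finitely many excitations -/

/-- The basis vectors with fewer than `N` photons. -/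
def photonBox (N : ℕ) : Finset (Fin 2 × ℕ) := Finset.univ ×ˢ Finset.range N

lemma mem_photonBox {N : ℕ} {i : Fin 2 × ℕ} : i ∈ photonBox N ↔ i.2 < N := by
  simp [photonBox]

/-- Matrices with fewer than `N` photons. -/
def SupportedBelow (N : ℕ) (X : JointOp) : Prop :=
  ∀ i j, X i j ≠ 0 → i ∈ photonBox N ∧ j ∈ photonBox N

lemma SupportedBelow.apply_eq_zero {N : ℕ} {X : JointOp} (hX : SupportedBelow N X)
    {i j : Fin 2 × ℕ} (h : N ≤ i.2) : X i j = 0 := by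
  by_contra hc
  have := mem_photonBox.1 (hX i j hc).1
  omega

lemma SupportedBelow.isTraceClass {N : ℕ} {X : JointOp} (hX : SupportedBelow N X) :
    IsTraceClass X := (traceClass_of_support hX).1

lemma SupportedBelow.isFinitelySupported {N : ℕ} {X : JointOp} (hX : SupportedBelow N X) :
    IsFinitelySupported X := isFinitelySupported_of_support hX

lemma IsFinitelySupported.exists_supportedBelow {X : JointOp} (hX : IsFinitelySupported X) :
    ∃ N, SupportedBelow N X := by
  obtain ⟨s, hs⟩ := hX.exists_finset
  refine ⟨s.sup Prod.snd + 1, fun i j hij => ?_⟩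
  simp only [mem_photonBox, Nat.lt_succ_iff]
  exact ⟨Finset.le_sup (f := Prod.snd) (hs i j hij).1, Finset.le_sup (f := Prod.snd) (hs i j hij).2⟩

lemma supportedBelow_single {N : ℕ} {i j : Fin 2 × ℕ} (hi : i ∈ photonBox N)
    (hj : j ∈ photonBox N) (c : ℂ) : SupportedBelow N (Matrix.single i j c) := by
  intro a b hab
  by_cases h : i = a ∧ j = b
  · exact ⟨h.1 ▸ hi, h.2 ▸ hj⟩
  · exact absurd (Matrix.single_apply_of_ne _ _ _ _ _ h) hab

lemma SupportedBelow.shift_eq_zero {N k : ℕ} {X : JointOp} (hX : SupportedBelow N X)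
    {i j : Fin 2 × ℕ} (h : ¬ (i ∈ photonBox N ∧ j ∈ photonBox N)) :
    X (shift k i) (shift k j) = 0 := by
  by_contra hc
  have := hX _ _ hc
  simp only [mem_photonBox, shift] at this h
  omega

/-- Photon loss only moves weight downwards, so the box is invariant. The telescoping argument for
uniqueness depends on this invariance. -/
lemma SupportedBelow.freeEvolution {N : ℕ} {X : JointOp} (hX : SupportedBelow N X) (t : ℝ) :
    SupportedBelow N (freeEvolution ωA ωc γ t X) := by
  intro i j hij
  by_contra hc
  refine hij ?_
  simp only [DissipativeJC.freeEvolution, Matrix.of_apply, hX.shift_eq_zero hc]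
  simp

lemma SupportedBelow.freeGenerator {N : ℕ} {X : JointOp} (hX : SupportedBelow N X) :
    SupportedBelow N (freeGenerator ωA ωc γ X) := by
  intro i j hij
  by_contra hc
  refine hij ?_
  have h0 := hX.shift_eq_zero (k := 0) hc
  rw [shift_zero, shift_zero] at h0
  rw [freeGenerator_apply, hX.shift_eq_zero hc, h0]
  simp

/-! ### The generator and the strong continuity of the explicit semigroup -/

lemma hasDerivAt_lossProb : HasDerivAt (lossProb γ) γ 0 := by
  have := ((hasDerivAt_id (0 : ℝ)).const_mul (-γ)).exp.const_sub 1
  simpa [show lossProb γ = fun t => 1 - Real.exp (-γ * t) from rfl] using this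

lemma tendsto_freeEvolution_apply (hγ : 0 ≤ γ) {N : ℕ} {X : JointOp} (hX : SupportedBelow N X)
    (i j : Fin 2 × ℕ) :
    Tendsto (fun s : ℝ => ((s⁻¹ : ℝ) : ℂ) * (freeEvolution ωA ωc γ s X i j - X i j)) (𝓝[>] 0)
      (𝓝 (freeGenerator ωA ωc γ X i j)) := by
  let L : ℂ := -(decayRate ωA ωc γ i + star (decayRate ωA ωc γ j))
  let c (k : ℕ) : ℂ :=
    (√((i.2 + k).choose k) * √((j.2 + k).choose k) : ℝ) * X (shift k i) (shift k j)
  let f (s : ℝ) : ℂ :=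
    ∑ k ∈ Finset.range (N + 2), Complex.exp (L * s) * ((lossProb γ s : ℝ) : ℂ) ^ k * c k
  have hf (s : ℝ) (hs : 0 ≤ s) : freeEvolution ωA ωc γ s X i j = f s := by
    rw [freeEvolution, Matrix.of_apply, tsum_eq_sum (s := Finset.range (N + 2))]
    · refine Finset.sum_congr rfl fun k _ => ?_
      rw [mul_right_comm, kraus_mul_star hγ hs]
      simp only [c, L, Complex.ofReal_mul, Complex.ofReal_pow]
      ring
    · intro k hk
      rw [hX.apply_eq_zero (i := shift k i) (by simp [shift] at hk ⊢; omega)]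
      simp
  have hd : HasDerivAt f (freeGenerator ωA ωc γ X i j) 0 := by
    have hE : HasDerivAt (fun s : ℝ => Complex.exp (L * s)) L 0 := by
      have := ((Complex.ofRealCLM.hasDerivAt (x := (0 : ℝ))).const_mul L).cexp
      simpa using this
    have hq : HasDerivAt (fun s : ℝ => ((lossProb γ s : ℝ) : ℂ)) γ 0 :=
      hasDerivAt_lossProb.ofReal_comp
    have h1 := HasDerivAt.fun_sum (u := Finset.range (N + 2)) fun k _ =>
      ((hE.mul (hq.pow k)).mul_const (c k))
    refine h1.congr_deriv ?_
    -- Since `q(0) = 0`, the terms with `k ≥ 2` have zero derivative; `k = 0` gives the decay rate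
    -- and `k = 1` the feeding term. The range `N + 2` ensures that both of these indices occur,
    -- even for `N = 0`.
    rw [Finset.sum_range_succ', Finset.sum_range_succ', Finset.sum_eq_zero]
    · rw [freeGenerator_apply]
      simp [lossProb_zero, c, L, shift_zero]
      ring
    · intro k _
      simp [lossProb_zero]
  have h2 := hd.tendsto_slope_zero_right
  refine h2.congr' ?_
  filter_upwards [self_mem_nhdsWithin] with s hs
  have hs : (0 : ℝ) < s := hs
  rw [zero_add, ← hf s hs.le, ← hf 0 le_rfl, freeEvolution_zero, Complex.real_smul]

/-- Everything stays in a fixed finite box, where the trace norm is at most the sum of the moduli of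
the entries; entrywise convergence therefore suffices. -/
lemma tendsto_traceNorm_generator (hγ : 0 ≤ γ) {N : ℕ} {X : JointOp} (hX : SupportedBelow N X) :
    Tendsto (fun s : ℝ => traceNorm (((s⁻¹ : ℝ) : ℂ) • (freeEvolution ωA ωc γ s X - X) -
      freeGenerator ωA ωc γ X)) (𝓝[>] 0) (𝓝 0) := by
  have hle (s : ℝ) : traceNorm (((s⁻¹ : ℝ) : ℂ) • (freeEvolution ωA ωc γ s X - X) -
      freeGenerator ωA ωc γ X) ≤ ∑ p ∈ photonBox N ×ˢ photonBox N,
        ‖((s⁻¹ : ℝ) : ℂ) * (freeEvolution ωA ωc γ s X p.1 p.2 - X p.1 p.2) -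
          freeGenerator ωA ωc γ X p.1 p.2‖ := by
    refine (traceClass_of_support fun i j hij => ?_).2
    by_contra hc
    refine hij ?_
    have e {Y : JointOp} (hY : SupportedBelow N Y) : Y i j = 0 := by
      by_contra h
      exact hc (hY i j h)
    simp [e hX, e (hX.freeEvolution (ωA := ωA) (ωc := ωc) (γ := γ) s),
      e (hX.freeGenerator (ωA := ωA) (ωc := ωc) (γ := γ))]
  refine squeeze_zero (fun s => traceNorm_nonneg _) hle ?_
  rw [← Finset.sum_const_zero (s := photonBox N ×ˢ photonBox N)]
  refine tendsto_finsetSum _ fun p _ => ?_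
  simpa using ((tendsto_freeEvolution_apply (ωA := ωA) (ωc := ωc) hγ hX p.1 p.2).sub
    (tendsto_const_nhds (x := freeGenerator ωA ωc γ X p.1 p.2))).norm

/-- On a box the existence of the derivative gives continuity; an `ε / 3` argument with density and
contractivity covers the whole trace class. -/
lemma tendsto_traceNorm_continuous (hγ : 0 ≤ γ) {X : JointOp} (hX : IsTraceClass X) :
    Tendsto (fun s : ℝ => traceNorm (freeEvolution ωA ωc γ s X - X)) (𝓝[>] 0) (𝓝 0) := by
  have hfin {N : ℕ} {F : JointOp} (hF : SupportedBelow N F) :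
      Tendsto (fun s : ℝ => traceNorm (freeEvolution ωA ωc γ s F - F)) (𝓝[>] 0) (𝓝 0) := by
    have hs : Tendsto (fun s : ℝ => s) (𝓝[>] 0) (𝓝 0) := nhdsWithin_le_nhds
    have h1 := hs.mul ((tendsto_traceNorm_generator (ωA := ωA) (ωc := ωc) hγ hF).add_const
      (traceNorm (freeGenerator ωA ωc γ F)))
    rw [zero_mul] at h1
    refine squeeze_zero' (Eventually.of_forall fun s => traceNorm_nonneg _) ?_ h1
    filter_upwards [self_mem_nhdsWithin] with s hs
    have hs : (0 : ℝ) < s := hs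
    have hD : IsTraceClass (freeEvolution ωA ωc γ s F - F) :=
      (hF.freeEvolution s).isTraceClass.sub hF.isTraceClass
    have hG : IsTraceClass (freeGenerator ωA ωc γ F) := hF.freeGenerator.isTraceClass
    have e : freeEvolution ωA ωc γ s F - F = (s : ℂ) •
        ((((s⁻¹ : ℝ) : ℂ) • (freeEvolution ωA ωc γ s F - F) - freeGenerator ωA ωc γ F) +
          freeGenerator ωA ωc γ F) := by
      rw [sub_add_cancel, smul_smul, ← Complex.ofReal_mul, mul_inv_cancel₀ hs.ne']
      simp
    have h2 := traceNorm_smul_le (s : ℂ) (((hD.smul ((s⁻¹ : ℝ) : ℂ)).sub hG).add hG)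
    rw [← e, Complex.norm_real, Real.norm_of_nonneg hs.le] at h2
    refine h2.trans ?_
    gcongr
    exact traceNorm_add_le ((hD.smul _).sub hG) hG
  refine Metric.tendsto_nhds.2 fun ε hε => ?_
  obtain ⟨F, hF, hFt, hlt⟩ := exists_finitelySupported_near hX (ε := ε / 3) (by positivity)
  obtain ⟨N, hN⟩ := hF.exists_supportedBelow
  filter_upwards [(hfin hN).eventually (gt_mem_nhds (by positivity : (0 : ℝ) < ε / 3)),
    self_mem_nhdsWithin] with s hs hs0
  have hs0 : (0 : ℝ) < s := hs0
  have hSX : IsTraceClass (freeEvolution ωA ωc γ s X) := hX.freeEvolution hγ hs0.le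
  have hSF : IsTraceClass (freeEvolution ωA ωc γ s F) := hFt.freeEvolution hγ hs0.le
  have h1 := traceNorm_sub_le hSX hSF hX
  have h2 := traceNorm_sub_le hSF hFt hX
  have h3 := traceNorm_freeEvolution_le (ωA := ωA) (ωc := ωc) hγ hs0.le (hX.sub hFt)
  rw [freeEvolution_sub hγ hs0.le hX hFt] at h3
  have h4 := traceNorm_sub_comm hX hFt
  rw [dist_zero_right, Real.norm_of_nonneg (traceNorm_nonneg _)]
  linarith

theorem isSemigroupGeneratedBy_freeEvolution (hγ : 0 ≤ γ) :
    IsSemigroupGeneratedBy (freeGenerator ωA ωc γ) (freeEvolution ωA ωc γ) where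
  map_traceClass _ hs _ hX := hX.freeEvolution hγ hs
  map_add _ hs _ _ hX hY := freeEvolution_add hγ hs hX hY
  map_smul s _ c X _ := freeEvolution_smul s c X
  bound := ⟨1, 0, fun s hs X hX => by simpa using traceNorm_freeEvolution_le hγ hs hX⟩
  zero X _ := freeEvolution_zero X
  add _ _ hs hr _ hX := freeEvolution_freeEvolution hγ hs hr hX
  continuous _ hX := tendsto_traceNorm_continuous hγ hX
  generator _ hX := by
    obtain ⟨N, hN⟩ := hX.exists_supportedBelow
    exact tendsto_traceNorm_generator hγ hN

/-! ### Uniqueness of the semigroup -/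

variable {𝒢 : JointOp → JointOp} {T : ℝ → JointOp → JointOp}

lemma IsSemigroupGeneratedBy.map_sub (hT : IsSemigroupGeneratedBy 𝒢 T) {s : ℝ} (hs : 0 ≤ s)
    {X Y : JointOp} (hX : IsTraceClass X) (hY : IsTraceClass Y) :
    T s (X - Y) = T s X - T s Y := by
  have := hT.map_add s hs _ _ (hX.sub hY) hY
  rw [sub_add_cancel] at this
  rw [this, add_sub_cancel_right]

lemma IsSemigroupGeneratedBy.map_sum (hT : IsSemigroupGeneratedBy 𝒢 T) {s : ℝ} (hs : 0 ≤ s)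
    {κ : Type} (F : Finset κ) {X : κ → JointOp} (hX : ∀ k ∈ F, IsTraceClass (X k)) :
    T s (∑ k ∈ F, X k) = ∑ k ∈ F, T s (X k) := by
  classical
  induction F using Finset.induction_on with
  | empty => simpa using hT.map_smul s hs 0 0 isTraceClass_zero
  | insert a F ha ih =>
    have hF : ∀ k ∈ F, IsTraceClass (X k) := fun k hk => hX k (Finset.mem_insert_of_mem hk)
    rw [Finset.sum_insert ha, Finset.sum_insert ha,
      hT.map_add s hs _ _ (hX a (Finset.mem_insert_self _ _)) (isTraceClass_sum hF), ih hF]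

lemma IsSemigroupGeneratedBy.exists_bound (hT : IsSemigroupGeneratedBy 𝒢 T) (t : ℝ) :
    ∃ B : ℝ, 0 ≤ B ∧ ∀ s, 0 ≤ s → s ≤ t → ∀ X, IsTraceClass X →
      traceNorm (T s X) ≤ B * traceNorm X := by
  obtain ⟨M, w, h⟩ := hT.bound
  refine ⟨|M| * Real.exp (|w| * t), by positivity, fun s hs hst X hX => (h s hs X hX).trans ?_⟩
  have := traceNorm_nonneg X
  gcongr
  · exact le_abs_self M
  · exact le_abs_self w

/-- The distance of `T s` from the explicit semigroup on the matrix units below `N` photons. -/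
noncomputable def stepError (ωA ωc γ : ℝ) (T : ℝ → JointOp → JointOp) (N : ℕ) (s : ℝ) : ℝ :=
  ∑ p ∈ photonBox N ×ˢ photonBox N, traceNorm
    (T s (Matrix.single p.1 p.2 1) - freeEvolution ωA ωc γ s (Matrix.single p.1 p.2 1))

/-- Expansion in matrix units, with each coefficient at most `traceNorm X`, makes the one-step error
uniform over the box. -/
lemma IsSemigroupGeneratedBy.step_le (hγ : 0 ≤ γ)
    (hT : IsSemigroupGeneratedBy (freeGenerator ωA ωc γ) T) {N : ℕ} {X : JointOp}
    (hX : SupportedBelow N X) {s : ℝ} (hs : 0 ≤ s) :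
    traceNorm (T s X - freeEvolution ωA ωc γ s X) ≤ stepError ωA ωc γ T N s * traceNorm X := by
  have hS := isSemigroupGeneratedBy_freeEvolution (ωA := ωA) (ωc := ωc) hγ
  have h1 (p : (Fin 2 × ℕ) × (Fin 2 × ℕ)) : IsTraceClass (Matrix.single p.1 p.2 (1 : ℂ)) :=
    (traceClass_single _ _ _).1
  have e : X = ∑ p ∈ photonBox N ×ˢ photonBox N, X p.1 p.2 • Matrix.single p.1 p.2 (1 : ℂ) := by
    simpa only [Matrix.smul_single, smul_eq_mul, mul_one] using eq_sum_single hX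
  have hD (p : (Fin 2 × ℕ) × (Fin 2 × ℕ)) := (hT.map_traceClass s hs _ (h1 p)).sub
    (hS.map_traceClass s hs _ (h1 p))
  have e2 : T s X - freeEvolution ωA ωc γ s X = ∑ p ∈ photonBox N ×ˢ photonBox N, X p.1 p.2 •
      (T s (Matrix.single p.1 p.2 1) - freeEvolution ωA ωc γ s (Matrix.single p.1 p.2 1)) := by
    conv_lhs => rw [e]
    rw [hT.map_sum hs _ fun p _ => (h1 p).smul _, hS.map_sum hs _ fun p _ => (h1 p).smul _,
      ← Finset.sum_sub_distrib]
    refine Finset.sum_congr rfl fun p _ => ?_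
    rw [hT.map_smul s hs _ _ (h1 p), hS.map_smul s hs _ _ (h1 p), smul_sub]
  rw [e2, stepError, Finset.sum_mul]
  refine (traceNorm_sum_le fun p _ => (hD p).smul _).trans (Finset.sum_le_sum fun p _ => ?_)
  refine (traceNorm_smul_le _ (hD p)).trans ?_
  rw [mul_comm]
  exact mul_le_mul_of_nonneg_left (norm_apply_le_traceNorm hX.isTraceClass _ _)
    (traceNorm_nonneg _)

/-- On each matrix unit both difference quotients converge to the same generator, so the one-step
error is `o(s)`. -/
lemma IsSemigroupGeneratedBy.tendsto_stepError (hγ : 0 ≤ γ)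
    (hT : IsSemigroupGeneratedBy (freeGenerator ωA ωc γ) T) (N : ℕ) :
    Tendsto (fun s : ℝ => s⁻¹ * stepError ωA ωc γ T N s) (𝓝[>] 0) (𝓝 0) := by
  have hS := isSemigroupGeneratedBy_freeEvolution (ωA := ωA) (ωc := ωc) hγ
  simp only [stepError, Finset.mul_sum]
  suffices h : ∀ p ∈ photonBox N ×ˢ photonBox N, Tendsto (fun s : ℝ => s⁻¹ * traceNorm
      (T s (Matrix.single p.1 p.2 1) - freeEvolution ωA ωc γ s (Matrix.single p.1 p.2 1)))
      (𝓝[>] 0) (𝓝 0) by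
    simpa using tendsto_finsetSum _ h
  intro p hp
  set E : JointOp := Matrix.single p.1 p.2 (1 : ℂ)
  have hE : SupportedBelow N E := by
    rw [Finset.mem_product] at hp
    exact supportedBelow_single hp.1 hp.2 1
  have h := (hT.generator E hE.isFinitelySupported).add (hS.generator E hE.isFinitelySupported)
  rw [add_zero] at h
  refine squeeze_zero' ?_ ?_ h
  · filter_upwards [self_mem_nhdsWithin] with s hs
    have hs : (0 : ℝ) < s := hs
    exact mul_nonneg (inv_nonneg.2 hs.le) (traceNorm_nonneg _)
  · filter_upwards [self_mem_nhdsWithin] with s hs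
    have hs : (0 : ℝ) < s := hs
    have hEt := hE.isTraceClass
    have hG : IsTraceClass (freeGenerator ωA ωc γ E) := hE.freeGenerator.isTraceClass
    have hA := (((hT.map_traceClass s hs.le _ hEt).sub hEt).smul ((s⁻¹ : ℝ) : ℂ)).sub hG
    have hB := (((hS.map_traceClass s hs.le _ hEt).sub hEt).smul ((s⁻¹ : ℝ) : ℂ)).sub hG
    have e : T s E - freeEvolution ωA ωc γ s E = (s : ℂ) •
        ((((s⁻¹ : ℝ) : ℂ) • (T s E - E) - freeGenerator ωA ωc γ E) -
          (((s⁻¹ : ℝ) : ℂ) • (freeEvolution ωA ωc γ s E - E) - freeGenerator ωA ωc γ E)) := by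
      rw [sub_sub_sub_cancel_right, ← smul_sub, sub_sub_sub_cancel_right, smul_smul,
        ← Complex.ofReal_mul, mul_inv_cancel₀ hs.ne']
      simp
    have h1 := traceNorm_smul_le (s : ℂ) (hA.sub hB)
    rw [← e, Complex.norm_real, Real.norm_of_nonneg hs.le] at h1
    rw [inv_mul_le_iff₀ hs]
    refine h1.trans (mul_le_mul_of_nonneg_left ?_ hs.le)
    have h2 := traceNorm_sub_le hA isTraceClass_zero hB
    rwa [sub_zero, traceNorm_sub_comm isTraceClass_zero hB, sub_zero] at h2

/-- Telescoping, with `S` the explicit semigroup: `T^{n+1} - S^{n+1} = T^n (T - S) + (T^n - S^n) S`.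
The first term is bounded by `B` times one step error; in the second, `S` keeps the matrix in the
box and contracts the norm, so induction applies. -/
lemma IsSemigroupGeneratedBy.iterate_step_le (hγ : 0 ≤ γ)
    (hT : IsSemigroupGeneratedBy (freeGenerator ωA ωc γ) T) {N : ℕ} {B t h : ℝ} (hB : 0 ≤ B)
    (hbound : ∀ s, 0 ≤ s → s ≤ t → ∀ X, IsTraceClass X → traceNorm (T s X) ≤ B * traceNorm X)
    (hh : 0 ≤ h) (n : ℕ) (hn : n * h ≤ t) {X : JointOp} (hX : SupportedBelow N X) :
    traceNorm (T (n * h) X - freeEvolution ωA ωc γ (n * h) X) ≤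
      n * (B * stepError ωA ωc γ T N h) * traceNorm X := by
  have hS := isSemigroupGeneratedBy_freeEvolution (ωA := ωA) (ωc := ωc) hγ
  induction n generalizing X with
  | zero =>
    simp [hT.zero X hX.isTraceClass, hS.zero X hX.isTraceClass, traceNorm_zero]
  | succ n ih =>
    have hXt := hX.isTraceClass
    have hnh : 0 ≤ n * h := by positivity
    push_cast at hn ⊢
    have hn' : n * h ≤ t := by linarith
    have hD := (hT.map_traceClass h hh _ hXt).sub (hS.map_traceClass h hh _ hXt)
    have hSX : SupportedBelow N (freeEvolution ωA ωc γ h X) := hX.freeEvolution h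
    have hSXt := hSX.isTraceClass
    rw [add_mul, one_mul, hT.add _ _ hnh hh _ hXt, hS.add _ _ hnh hh _ hXt]
    have h1 := traceNorm_sub_le (hT.map_traceClass _ hnh _ (hT.map_traceClass h hh _ hXt))
      (hT.map_traceClass _ hnh _ hSXt) (hS.map_traceClass _ hnh _ hSXt)
    have h2 := hbound _ hnh hn' _ hD
    rw [hT.map_sub hnh (hT.map_traceClass h hh _ hXt) hSXt] at h2
    have h3 := mul_le_mul_of_nonneg_left (hT.step_le hγ hX hh) hB
    have h4 := ih hn' hSX
    have h5 : 0 ≤ stepError ωA ωc γ T N h := Finset.sum_nonneg fun _ _ => traceNorm_nonneg _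
    have h6 := mul_le_mul_of_nonneg_left
      (traceNorm_freeEvolution_le (ωA := ωA) (ωc := ωc) hγ hh hXt)
      (by positivity : 0 ≤ n * (B * stepError ωA ωc γ T N h))
    linarith

/-- The free generator determines the semigroup. -/
theorem IsSemigroupGeneratedBy.eq_freeEvolution (hγ : 0 ≤ γ)
    (hT : IsSemigroupGeneratedBy (freeGenerator ωA ωc γ) T) {t : ℝ} (ht : 0 ≤ t) {X : JointOp}
    (hX : IsTraceClass X) : T t X = freeEvolution ωA ωc γ t X := by
  have hS := isSemigroupGeneratedBy_freeEvolution (ωA := ωA) (ωc := ωc) hγ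
  obtain ⟨B, hB, hbound⟩ := hT.exists_bound t
  have hfin {N : ℕ} {F : JointOp} (hF : SupportedBelow N F) :
      T t F = freeEvolution ωA ωc γ t F := by
    rcases ht.eq_or_lt with rfl | htpos
    · rw [hT.zero F hF.isTraceClass, hS.zero F hF.isTraceClass]
    have hlim : Tendsto (fun n : ℕ => t / ((n : ℝ) + 1)) atTop (𝓝[>] 0) := by
      refine tendsto_nhdsWithin_iff.2 ⟨?_, Eventually.of_forall fun n => ?_⟩
      · simpa [div_eq_mul_inv] using (tendsto_one_div_add_atTop_nhds_zero_nat (𝕜 := ℝ)).const_mul t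
      · exact div_pos htpos (by positivity)
    -- With step `t / (n + 1)` the accumulated error is `B t ‖F‖` times the step error divided by
    -- the step.
    have h1 := ((hT.tendsto_stepError hγ N).comp hlim).const_mul (B * t * traceNorm F)
    rw [mul_zero] at h1
    refine eq_of_traceNorm_sub_eq_zero (hT.map_traceClass t ht _ hF.isTraceClass)
      (hS.map_traceClass t ht _ hF.isTraceClass) (ge_of_tendsto' h1 fun n => ?_)
    have hn : ((n + 1 : ℕ) : ℝ) * (t / ((n : ℝ) + 1)) = t := by push_cast; field_simp
    have h2 := hT.iterate_step_le hγ hB hbound (h := t / ((n : ℝ) + 1)) (by positivity) (n + 1)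
      hn.le hF
    rw [hn] at h2
    refine h2.trans (le_of_eq ?_)
    simp only [Function.comp_apply]
    push_cast
    field_simp
  refine eq_of_traceNorm_sub_eq_zero (hT.map_traceClass t ht _ hX) (hS.map_traceClass t ht _ hX)
    (le_of_forall_pos_le_add fun ε hε => ?_)
  -- The two evolutions of `X - F` cost at most `B` and `1` times its norm, which explains the
  -- divisor `B + 1`.
  obtain ⟨F, hF, hFt, hlt⟩ := exists_finitelySupported_near hX (ε := ε / (B + 1)) (by positivity)
  obtain ⟨N, hN⟩ := hF.exists_supportedBelow
  have h1 := traceNorm_sub_le (hT.map_traceClass t ht _ hX) (hT.map_traceClass t ht _ hFt)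
    (hS.map_traceClass t ht _ hX)
  have h2 := hbound t ht le_rfl _ (hX.sub hFt)
  have h3 := traceNorm_freeEvolution_le (ωA := ωA) (ωc := ωc) hγ ht (hFt.sub hX)
  rw [hT.map_sub ht hX hFt] at h2
  rw [freeEvolution_sub hγ ht hFt hX, ← hfin hN, traceNorm_sub_comm hFt hX] at h3
  have h4 : (B + 1) * traceNorm (X - F) ≤ ε := by
    rw [lt_div_iff₀ (by positivity)] at hlt
    linarith
  linarith

/-! ### Product operators and coherent states -/

/-- The rank-one operator `|u⟩⟨v|` of the mode. -/
def ketBra (u v : ℕ → ℂ) : ModeOp := Matrix.of fun m n => u m * star (v n)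

/-- `b†` applied to a vector. -/
noncomputable def creationVec (u : ℕ → ℂ) : ℕ → ℂ := fun m => ∑ k ∈ Finset.range m, creation m k * u k

/-- `b` applied to a vector. -/
noncomputable def annihilationVec (u : ℕ → ℂ) : ℕ → ℂ := fun m => (√(m + 1 : ℝ) : ℝ) * u (m + 1)

lemma coherentProj_eq (z : ℂ) : coherentProj z = ketBra (coherent z) (coherent z) := rfl

lemma summable_atom_mul {u : ℕ → ℂ} (hu : Summable fun n => ‖u n‖ ^ 2) (c : Fin 2 → ℂ) :
    Summable fun i : Fin 2 × ℕ => ‖c i.1 * u i.2‖ ^ 2 := by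
  refine (summable_prod_of_nonneg fun _ => by positivity).2
    ⟨fun a => ?_, (hasSum_fintype _).summable⟩
  simpa only [norm_mul, mul_pow] using hu.mul_left (‖c a‖ ^ 2)

/-- With `e_a` the atomic basis, the operator is the finite sum over `a` of `|A e_a ⊗ u⟩⟨e_a ⊗ v|`.
-/
lemma isTraceClass_kronecker_ketBra (A : AtomOp) {u v : ℕ → ℂ} (hu : Summable fun n => ‖u n‖ ^ 2)
    (hv : Summable fun n => ‖v n‖ ^ 2) : IsTraceClass (A ⊗ₖ ketBra u v) := by
  choose x hx using fun a : Fin 2 => exists_lp_eq (summable_atom_mul hu fun b => A b a)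
  choose y hy using fun a : Fin 2 => exists_lp_eq (summable_atom_mul hv fun b => (1 : AtomOp) b a)
  refine (traceClass_of_hasSum (u := x) (v := y) (hasSum_fintype _).summable fun i j => ?_).1
  have h := hasSum_fintype fun a => (x a : Fin 2 × ℕ → ℂ) i * star ((y a : Fin 2 × ℕ → ℂ) j)
  convert h using 1
  rw [Finset.sum_eq_single j.1]
  · simp [hx, hy, Matrix.kroneckerMap_apply, ketBra, mul_assoc]
  · intro a _ ha
    simp [hy, Matrix.one_apply_ne' ha]
  · simp

lemma partialTrace_kronecker (A : AtomOp) (u v : ℕ → ℂ) :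
    partialTrace (A ⊗ₖ ketBra u v) = (∑' n, u n * star (v n)) • A := by
  ext a b
  simp only [partialTrace, Matrix.of_apply, Matrix.kroneckerMap_apply, ketBra, tsum_mul_left,
    Matrix.smul_apply, smul_eq_mul]
  ring

lemma partialTrace_add {X Y : JointOp} (hX : IsTraceClass X) (hY : IsTraceClass Y) :
    partialTrace (X + Y) = partialTrace X + partialTrace Y := by
  ext a b
  exact (summable_norm_apply hX (Prod.mk_right_injective a)
    (Prod.mk_right_injective b)).of_norm.tsum_add
      (summable_norm_apply hY (Prod.mk_right_injective a) (Prod.mk_right_injective b)).of_norm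

lemma partialTrace_smul (c : ℂ) (X : JointOp) : partialTrace (c • X) = c • partialTrace X := by
  ext a b
  simp [partialTrace, tsum_mul_left]

lemma partialTrace_sub {X Y : JointOp} (hX : IsTraceClass X) (hY : IsTraceClass Y) :
    partialTrace (X - Y) = partialTrace X - partialTrace Y := by
  have := partialTrace_add (hX.sub hY) hY
  rw [sub_add_cancel] at this
  rw [this, add_sub_cancel_right]

/-! ### Products of infinite matrices with finite rows or columns -/

lemma add_opMul {ι : Type} {A B : Matrix ι ι ℂ} (hA : ∀ i, (Function.support (A i)).Finite)
    (hB : ∀ i, (Function.support (B i)).Finite) (X : Matrix ι ι ℂ) :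
    (A + B) ⋄ X = A ⋄ X + B ⋄ X := by
  ext i j
  simp only [opMul, Matrix.of_apply, Matrix.add_apply, add_mul]
  refine Summable.tsum_add ?_ ?_
  · exact summable_of_hasFiniteSupport ((hA i).subset fun k hk => left_ne_zero_of_mul hk)
  · exact summable_of_hasFiniteSupport ((hB i).subset fun k hk => left_ne_zero_of_mul hk)

lemma opMul_add {ι : Type} {A B : Matrix ι ι ℂ}
    (hA : ∀ j, (Function.support fun i => A i j).Finite)
    (hB : ∀ j, (Function.support fun i => B i j).Finite) (X : Matrix ι ι ℂ) :
    X ⋄ (A + B) = X ⋄ A + X ⋄ B := by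
  ext i j
  simp only [opMul, Matrix.of_apply, Matrix.add_apply, mul_add]
  refine Summable.tsum_add ?_ ?_
  · exact summable_of_hasFiniteSupport ((hA j).subset fun k hk => right_ne_zero_of_mul hk)
  · exact summable_of_hasFiniteSupport ((hB j).subset fun k hk => right_ne_zero_of_mul hk)

lemma smul_opMul {ι : Type} (c : ℂ) (A X : Matrix ι ι ℂ) : (c • A) ⋄ X = c • (A ⋄ X) := by
  ext i j
  simp [opMul, mul_assoc, tsum_mul_left]

lemma opMul_smul {ι : Type} (c : ℂ) (A X : Matrix ι ι ℂ) : X ⋄ (c • A) = c • (X ⋄ A) := by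
  ext i j
  simp [opMul, mul_left_comm, tsum_mul_left]

/-- The finiteness condition makes the series over the product index summable, so it may be split
into the atomic sum and the mode series. -/
lemma kronecker_opMul_kronecker (A A' : AtomOp) {B B' : ModeOp}
    (h : ∀ m n, (Function.support fun k => B m k * B' k n).Finite) :
    (A ⊗ₖ B) ⋄ (A' ⊗ₖ B') = (A * A') ⊗ₖ (B ⋄ B') := by
  ext ⟨a, m⟩ ⟨b, n⟩
  have hs (c : Fin 2) : Summable fun k => (A a c * B m k) * (A' c b * B' k n) := by
    have h' : Summable fun k => B m k * B' k n := summable_of_hasFiniteSupport (h m n)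
    refine (summable_congr fun k => ?_).2 (h'.mul_left (A a c * A' c b))
    ring
  have hs' : Summable fun p : Fin 2 × ℕ => (A a p.1 * B m p.2) * (A' p.1 b * B' p.2 n) := by
    refine summable_of_hasFiniteSupport (((Set.finite_univ (α := Fin 2)).prod (h m n)).subset ?_)
    rintro ⟨c, k⟩ hk
    refine ⟨trivial, fun h0 => hk ?_⟩
    simp only at h0 ⊢
    linear_combination A a c * A' c b * h0
  simp only [opMul, Matrix.of_apply, Matrix.kroneckerMap_apply]
  rw [hs'.tsum_prod' hs, tsum_fintype, Matrix.mul_apply, Finset.sum_mul]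
  refine Finset.sum_congr rfl fun c _ => ?_
  rw [← tsum_mul_left]
  exact tsum_congr fun k => by ring

lemma annihilation_row_finite (m : ℕ) : (Function.support fun k => annihilation m k).Finite :=
  (Set.finite_singleton (m + 1)).subset fun k hk => by
    by_contra h
    exact hk (if_neg h)

lemma annihilation_col_finite (n : ℕ) : (Function.support fun k => annihilation k n).Finite :=
  (Set.finite_Iio n).subset fun k hk => by
    by_contra h
    exact hk (if_neg fun e => h (by simp [e]))

lemma creation_row_finite (m : ℕ) : (Function.support fun k => creation m k).Finite :=
  (annihilation_col_finite m).subset fun k hk => by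
    simpa [creation] using hk

lemma creation_col_finite (n : ℕ) : (Function.support fun k => creation k n).Finite :=
  (annihilation_row_finite n).subset fun k hk => by
    simpa [creation] using hk

lemma kronecker_row_finite (A : AtomOp) {B : ModeOp}
    (h : ∀ m, (Function.support fun k => B m k).Finite) (i : Fin 2 × ℕ) :
    (Function.support ((A ⊗ₖ B) i)).Finite :=
  ((Set.finite_univ (α := Fin 2)).prod (h i.2)).subset fun _ hp =>
    ⟨trivial, right_ne_zero_of_mul hp⟩

lemma kronecker_col_finite (A : AtomOp) {B : ModeOp}
    (h : ∀ n, (Function.support fun k => B k n).Finite) (j : Fin 2 × ℕ) :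
    (Function.support fun i => (A ⊗ₖ B) i j).Finite :=
  ((Set.finite_univ (α := Fin 2)).prod (h j.2)).subset fun _ hp =>
    ⟨trivial, right_ne_zero_of_mul hp⟩

lemma creationVec_zero (u : ℕ → ℂ) : creationVec u 0 = 0 := by simp [creationVec]

lemma creationVec_succ (u : ℕ → ℂ) (m : ℕ) :
    creationVec u (m + 1) = (√(m + 1 : ℝ) : ℝ) * u m := by
  rw [creationVec, Finset.sum_eq_single m]
  · simp [creation_apply]
  · intro k _ hk
    simp [creation_apply, hk.symm]
  · simp

lemma annihilation_opMul_ketBra (u v : ℕ → ℂ) :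
    annihilation ⋄ ketBra u v = ketBra (annihilationVec u) v := by
  ext m n
  rw [opMul, Matrix.of_apply, tsum_eq_single (m + 1)]
  · simp [annihilation_apply, ketBra, annihilationVec, mul_assoc]
  · intro k hk
    simp [annihilation_apply, hk]

lemma ketBra_opMul_creation (u v : ℕ → ℂ) :
    ketBra u v ⋄ creation = ketBra u (annihilationVec v) := by
  ext m n
  rw [opMul, Matrix.of_apply, tsum_eq_single (n + 1)]
  · simp [creation_apply, ketBra, annihilationVec, mul_comm, mul_left_comm]
  · intro k hk
    simp [creation_apply, hk]

lemma creation_opMul_ketBra (u v : ℕ → ℂ) :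
    creation ⋄ ketBra u v = ketBra (creationVec u) v := by
  ext m n
  rw [opMul, Matrix.of_apply, tsum_eq_sum (s := Finset.range m)]
  · simp [ketBra, creationVec, Finset.sum_mul, mul_assoc]
  · intro k hk
    have : m ≠ k + 1 := by simp at hk; omega
    simp [creation_apply, this]

lemma star_creation_apply (m n : ℕ) : star (creation m n) = annihilation n m := by
  simp [creation]

lemma ketBra_opMul_annihilation (u v : ℕ → ℂ) :
    ketBra u v ⋄ annihilation = ketBra u (creationVec v) := by
  ext m n
  rw [opMul, Matrix.of_apply, tsum_eq_sum (s := Finset.range n)]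
  · simp only [ketBra, creationVec, Matrix.of_apply, star_sum, star_mul', star_creation_apply,
      Finset.mul_sum]
    exact Finset.sum_congr rfl fun k _ => by ring
  · intro k hk
    have : n ≠ k + 1 := by simp at hk; omega
    simp [annihilation_apply, this]

/-! ### Coherent states and the interaction acting on them -/

lemma norm_coherent_sq (z : ℂ) (n : ℕ) :
    ‖coherent z n‖ ^ 2 = Real.exp (-‖z‖ ^ 2) * ((‖z‖ ^ 2) ^ n / n.factorial) := by
  rw [coherent, norm_div, norm_mul, Complex.norm_real, Complex.norm_real, div_pow, mul_pow,
    Real.norm_of_nonneg (Real.exp_nonneg _), Real.norm_of_nonneg (Real.sqrt_nonneg _),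
    Real.sq_sqrt (by positivity), ← Real.exp_nat_mul, norm_pow]
  rw [show ((2 : ℕ) : ℝ) * (-‖z‖ ^ 2 / 2) = -‖z‖ ^ 2 by push_cast; ring]
  ring

lemma hasSum_norm_coherent_sq (z : ℂ) : HasSum (fun n => ‖coherent z n‖ ^ 2) 1 := by
  have h := (NormedSpace.expSeries_div_hasSum_exp (‖z‖ ^ 2)).mul_left (Real.exp (-‖z‖ ^ 2))
  rw [← Real.exp_eq_exp_ℝ, ← Real.exp_add, neg_add_cancel, Real.exp_zero] at h
  exact hasSum_of_forall_eq h fun n => norm_coherent_sq z n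

lemma hasSum_coherent_mul_star (z : ℂ) :
    HasSum (fun n => coherent z n * star (coherent z n)) 1 := by
  have h := Complex.hasSum_ofReal.2 (hasSum_norm_coherent_sq z)
  rw [Complex.ofReal_one] at h
  exact hasSum_of_forall_eq h fun n => by
    rw [RCLike.star_def, Complex.mul_conj']
    push_cast
    rfl

lemma sqrt_succ_mul_coherent (z : ℂ) (n : ℕ) :
    ((√(n + 1 : ℝ) : ℝ) : ℂ) * coherent z (n + 1) = z * coherent z n := by
  have h1 : ((√(n.factorial : ℝ) : ℝ) : ℂ) ≠ 0 := by
    exact_mod_cast (Real.sqrt_pos.2 (by positivity)).ne'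
  have h2 : ((√(n + 1 : ℝ) : ℝ) : ℂ) ≠ 0 := by
    exact_mod_cast (Real.sqrt_pos.2 (by positivity)).ne'
  rw [coherent, coherent, Nat.factorial_succ, Nat.cast_mul, Real.sqrt_mul (by positivity)]
  push_cast
  field_simp
  ring

lemma annihilationVec_coherent (z : ℂ) :
    annihilationVec (coherent z) = fun n => z * coherent z n :=
  funext fun n => sqrt_succ_mul_coherent z n

lemma ketBra_mul_left (c : ℂ) (u v : ℕ → ℂ) : ketBra (fun n => c * u n) v = c • ketBra u v := by
  ext m n
  simp [ketBra, mul_assoc]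

lemma ketBra_mul_right (c : ℂ) (u v : ℕ → ℂ) :
    ketBra u (fun n => c * v n) = star c • ketBra u v := by
  ext m n
  simp [ketBra, mul_left_comm]

/-- Although `b†` is unbounded, `b†|z⟩` is square-summable: the new factor satisfies `n + 1 ≤ 2^n`,
which leaves an exponential series in `2 ‖z‖²`. -/
lemma summable_norm_creationVec_coherent_sq (z : ℂ) :
    Summable fun n => ‖creationVec (coherent z) n‖ ^ 2 := by
  rw [← summable_nat_add_iff 1]
  have h := ((NormedSpace.expSeries_div_summable (2 * ‖z‖ ^ 2)).mul_left (Real.exp (-‖z‖ ^ 2)))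
  refine Summable.of_nonneg_of_le (fun _ => by positivity) (fun n => ?_) h
  rw [creationVec_succ, norm_mul, mul_pow, norm_coherent_sq, Complex.norm_real,
    Real.norm_of_nonneg (Real.sqrt_nonneg _), Real.sq_sqrt (by positivity), mul_pow]
  have h2 : ((n : ℝ) + 1) ≤ 2 ^ n := by exact_mod_cast Nat.lt_two_pow_self (n := n)
  calc ((n : ℝ) + 1) * (Real.exp (-‖z‖ ^ 2) * ((‖z‖ ^ 2) ^ n / n.factorial))
      ≤ 2 ^ n * (Real.exp (-‖z‖ ^ 2) * ((‖z‖ ^ 2) ^ n / n.factorial)) := by gcongr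
    _ = _ := by ring

/-- This is `tr(|z⟩⟨z| b) = ⟨z|b|z⟩ = z`. The zeroth entry of `b†|z⟩` vanishes, so the index may be
shifted and `b` moved back onto the coherent ket. -/
lemma hasSum_coherent_mul_star_creationVec (z : ℂ) :
    HasSum (fun n => coherent z n * star (creationVec (coherent z) n)) z := by
  rw [← hasSum_nat_add_iff' 1]
  have h := (hasSum_coherent_mul_star z).mul_left z
  simp only [Finset.sum_range_one, creationVec_zero, star_zero, mul_zero, sub_zero]
  rw [mul_one] at h
  refine hasSum_of_forall_eq h fun n => ?_
  simp only [creationVec_succ, star_mul', RCLike.star_def, Complex.conj_ofReal]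
  linear_combination (starRingEnd ℂ) (coherent z n) * sqrt_succ_mul_coherent z n

lemma hasSum_creationVec_mul_star_coherent (z : ℂ) :
    HasSum (fun n => creationVec (coherent z) n * star (coherent z n)) (star z) := by
  have h := (hasSum_coherent_mul_star_creationVec z).star
  exact hasSum_of_forall_eq h fun n => by rw [star_mul', star_star, mul_comm]

lemma isTraceClass_kronecker_coherentProj (A : AtomOp) (z : ℂ) :
    IsTraceClass (A ⊗ₖ coherentProj z) :=
  isTraceClass_kronecker_ketBra A (hasSum_norm_coherent_sq z).summable
    (hasSum_norm_coherent_sq z).summable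

lemma partialTrace_kronecker_coherentProj (A : AtomOp) (z : ℂ) :
    partialTrace (A ⊗ₖ coherentProj z) = A := by
  rw [coherentProj_eq, partialTrace_kronecker, (hasSum_coherent_mul_star z).tsum_eq, one_smul]

/-- Two of the four terms are scalar multiples, from `b|w⟩ = w|w⟩` and `⟨w|b† = w̄⟨w|`. The other
two retain `b†|w⟩` or `⟨w|b` and become scalars only under the partial trace. -/
lemma interaction_kronecker_coherentProj (g w : ℂ) (A : AtomOp) :
    interaction g (A ⊗ₖ coherentProj w) = (-Complex.I) •
      (((g * w) • ((sigmaPlus * A) ⊗ₖ ketBra (coherent w) (coherent w)) +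
        star g • ((sigmaMinus * A) ⊗ₖ ketBra (creationVec (coherent w)) (coherent w))) -
      (g • ((A * sigmaPlus) ⊗ₖ ketBra (coherent w) (creationVec (coherent w))) +
        (star g * star w) • ((A * sigmaMinus) ⊗ₖ ketBra (coherent w) (coherent w)))) := by
  have hfin {ι : Type} {A : Matrix ι ι ℂ} (h : ∀ i, (Function.support (A i)).Finite) (c : ℂ)
      (i : ι) : (Function.support ((c • A) i)).Finite :=
    (h i).subset fun _ hk => right_ne_zero_of_mul hk
  have hfin' {ι : Type} {A : Matrix ι ι ℂ} (h : ∀ j, (Function.support fun i => A i j).Finite)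
      (c : ℂ) (j : ι) : (Function.support fun i => (c • A) i j).Finite :=
    (h j).subset fun _ hk => right_ne_zero_of_mul hk
  rw [interaction, interactionHamiltonian,
    add_opMul (hfin (kronecker_row_finite _ annihilation_row_finite) _)
      (hfin (kronecker_row_finite _ creation_row_finite) _),
    opMul_add (hfin' (kronecker_col_finite _ annihilation_col_finite) _)
      (hfin' (kronecker_col_finite _ creation_col_finite) _),
    smul_opMul, smul_opMul, opMul_smul, opMul_smul, coherentProj_eq,
    kronecker_opMul_kronecker _ _ fun m n => (annihilation_row_finite m).subset fun k hk =>
      left_ne_zero_of_mul hk,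
    kronecker_opMul_kronecker _ _ fun m n => (creation_row_finite m).subset fun k hk =>
      left_ne_zero_of_mul hk,
    kronecker_opMul_kronecker _ _ fun m n => (annihilation_col_finite n).subset fun k hk =>
      right_ne_zero_of_mul hk,
    kronecker_opMul_kronecker _ _ fun m n => (creation_col_finite n).subset fun k hk =>
      right_ne_zero_of_mul hk,
    annihilation_opMul_ketBra, creation_opMul_ketBra, ketBra_opMul_annihilation,
    ketBra_opMul_creation, annihilationVec_coherent, ketBra_mul_left, ketBra_mul_right,
    Matrix.kronecker_smul, Matrix.kronecker_smul, smul_smul, smul_smul]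

lemma isTraceClass_interaction (g w : ℂ) (A : AtomOp) :
    IsTraceClass (interaction g (A ⊗ₖ coherentProj w)) := by
  have h1 := (hasSum_norm_coherent_sq w).summable
  have h2 := summable_norm_creationVec_coherent_sq w
  rw [interaction_kronecker_coherentProj]
  exact ((((isTraceClass_kronecker_ketBra _ h1 h1).smul _).add
    ((isTraceClass_kronecker_ketBra _ h2 h1).smul _)).sub
    (((isTraceClass_kronecker_ketBra _ h1 h2).smul _).add
    ((isTraceClass_kronecker_ketBra _ h1 h1).smul _))).smul _

/-- The parametric approximation originates here: under the trace over the mode, all occurrences of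
`b` and `b†` become `w` and `w̄`. -/
lemma partialTrace_interaction (g w : ℂ) (A : AtomOp) :
    partialTrace (interaction g (A ⊗ₖ coherentProj w)) =
      (-Complex.I) • ⁅parametricHamiltonian g w, A⁆ := by
  have h1 := (hasSum_norm_coherent_sq w).summable
  have h2 := summable_norm_creationVec_coherent_sq w
  have t1 := (isTraceClass_kronecker_ketBra (sigmaPlus * A) h1 h1).smul (g * w)
  have t2 := (isTraceClass_kronecker_ketBra (sigmaMinus * A) h2 h1).smul (star g)
  have t3 := (isTraceClass_kronecker_ketBra (A * sigmaPlus) h1 h2).smul g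
  have t4 := (isTraceClass_kronecker_ketBra (A * sigmaMinus) h1 h1).smul (star g * star w)
  rw [interaction_kronecker_coherentProj, partialTrace_smul, partialTrace_sub (t1.add t2)
    (t3.add t4), partialTrace_add t1 t2, partialTrace_add t3 t4]
  simp only [partialTrace_smul, partialTrace_kronecker, (hasSum_coherent_mul_star w).tsum_eq,
    (hasSum_creationVec_mul_star_coherent w).tsum_eq,
    (hasSum_coherent_mul_star_creationVec w).tsum_eq, one_smul, smul_smul]
  rw [parametricHamiltonian, Ring.lie_def, add_mul, mul_add]
  simp only [smul_mul_assoc, mul_smul_comm]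

/-! ### The free evolution of product states -/

/-- The evolution of the free atom. -/
noncomputable def atomEvolution (ωA t : ℝ) (A : AtomOp) : AtomOp :=
  Matrix.of fun a b => Complex.exp (-Complex.I * ωA * ((a : ℕ) - (b : ℕ) : ℂ) * t) * A a b

/-- The amplitude `z(t)` of the damped coherent state. -/
noncomputable def amplitude (ωc γ : ℝ) (z : ℂ) (t : ℝ) : ℂ :=
  z * Complex.exp ((-Complex.I * ωc - (γ : ℂ) / 2) * t)

lemma exp_decayRate (i j : Fin 2 × ℕ) (t : ℝ) :
    Complex.exp (-(decayRate ωA ωc γ i + star (decayRate ωA ωc γ j)) * t) =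
      Complex.exp (-Complex.I * ωA * ((i.1 : ℕ) - (j.1 : ℕ) : ℂ) * t) *
        (Complex.exp ((-Complex.I * ωc - (γ : ℂ) / 2) * t) ^ i.2 *
          star (Complex.exp ((-Complex.I * ωc - (γ : ℂ) / 2) * t)) ^ j.2) := by
  rw [RCLike.star_def, ← Complex.exp_conj, ← Complex.exp_nat_mul, ← Complex.exp_nat_mul,
    ← Complex.exp_add, ← Complex.exp_add]
  congr 1
  simp [decayRate]
  ring

lemma exp_mul_star_exp (t : ℝ) : Complex.exp ((-Complex.I * ωc - (γ : ℂ) / 2) * t) *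
    star (Complex.exp ((-Complex.I * ωc - (γ : ℂ) / 2) * t)) = (Real.exp (-γ * t) : ℝ) := by
  rw [RCLike.star_def, ← Complex.exp_conj, ← Complex.exp_add, Complex.ofReal_exp]
  congr 1
  simp [map_ofNat]
  ring

/-- Photon loss preserves the trace over the mode: on entries diagonal in the photon number the loss
probabilities sum to one, and only the atomic phase remains. -/
theorem partialTrace_freeEvolution (hγ : 0 ≤ γ) {t : ℝ} (ht : 0 ≤ t) {X : JointOp}
    (hX : IsTraceClass X) :
    partialTrace (freeEvolution ωA ωc γ t X) = atomEvolution ωA t (partialTrace X) := by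
  ext a b
  have hG := summable_norm_apply hX (Prod.mk_right_injective a) (Prod.mk_right_injective b)
  have h := hasSum_choose_mul (𝕜 := ℂ) (G := fun n => X (a, n) (b, n)) (lossProb_nonneg hγ ht)
    (Real.exp_nonneg (-γ * t)) (by
      simpa only [add_comm (lossProb γ t), exp_add_lossProb, one_pow, one_mul] using hG)
  simp only [add_comm (lossProb γ t), exp_add_lossProb, one_pow, RCLike.ofReal_one, one_mul] at h
  -- The swap puts the number of surviving photons first, so that summing over the losses gives the
  -- diagonal entries of the evolved matrix.
  have h2 := (Equiv.prodComm ℕ ℕ).hasSum_iff.2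
    (h.mul_left (Complex.exp (-Complex.I * ωA * ((a : ℕ) - (b : ℕ) : ℂ) * t)))
  have h3 := HasSum.prod_fiberwise (g := fun m => freeEvolution ωA ωc γ t X (a, m) (b, m)) h2
    fun m => by
      refine hasSum_of_forall_eq (summable_freeEvolution (ωA := ωA) (ωc := ωc) hγ ht hX (a, m)
        (b, m)).of_norm.hasSum fun k => ?_
      rw [mul_right_comm (kraus _ _ _ _ _ _), kraus_mul_star hγ ht, exp_decayRate, ← mul_pow,
        exp_mul_star_exp, Real.mul_self_sqrt (by positivity)]
      simp only [Function.comp_apply, Equiv.prodComm_apply, Prod.swap, shift, add_comm k m]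
      simp
      ring
  exact h3.tsum_eq

lemma norm_amplitude_sq (z : ℂ) (t : ℝ) :
    ‖amplitude ωc γ z t‖ ^ 2 = Real.exp (-γ * t) * ‖z‖ ^ 2 := by
  rw [amplitude, norm_mul, mul_pow, Complex.norm_exp, ← Real.exp_nat_mul, mul_comm]
  congr 2
  simp
  ring

/-- Damping multiplies the `n`-photon amplitude by the `n`-th power of the one-photon factor; the
real exponential restores the normalization, since `‖z‖² - ‖z(t)‖² = q ‖z‖²`. -/
lemma coherent_amplitude (z : ℂ) (t : ℝ) (n : ℕ) : coherent (amplitude ωc γ z t) n =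
    (Real.exp (lossProb γ t * ‖z‖ ^ 2 / 2) : ℝ) *
      Complex.exp ((-Complex.I * ωc - (γ : ℂ) / 2) * t) ^ n * coherent z n := by
  have e : Real.exp (-‖amplitude ωc γ z t‖ ^ 2 / 2) =
      Real.exp (lossProb γ t * ‖z‖ ^ 2 / 2) * Real.exp (-‖z‖ ^ 2 / 2) := by
    rw [norm_amplitude_sq, ← Real.exp_add, lossProb]
    ring_nf
  rw [coherent, coherent, e, amplitude, mul_pow]
  push_cast
  ring

/-- Removing `k` photons from a coherent state returns the same state up to a scalar, so each Kraus
term is proportional to the same coherent projector. -/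
lemma sqrt_choose_mul_coherent (z : ℂ) (m k : ℕ) :
    ((√((m + k).choose k : ℝ) : ℝ) : ℂ) * coherent z (m + k) =
      z ^ k / ((√(k.factorial : ℝ) : ℝ) : ℂ) * coherent z m := by
  have hf (n : ℕ) : ((√(n.factorial : ℝ) : ℝ) : ℂ) ≠ 0 := by
    exact_mod_cast (Real.sqrt_pos.2 (by positivity)).ne'
  have h : ((√((m + k).choose k : ℝ) : ℝ) : ℂ) * ((√(k.factorial : ℝ) : ℝ) : ℂ) *
      ((√(m.factorial : ℝ) : ℝ) : ℂ) = ((√((m + k).factorial : ℝ) : ℝ) : ℂ) := by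
    rw [← Complex.ofReal_mul, ← Complex.ofReal_mul, ← Real.sqrt_mul (by positivity),
      ← Real.sqrt_mul (by positivity)]
    congr 2
    have := Nat.add_choose_mul_factorial_mul_factorial m k
    rw [← this]
    push_cast
    ring
  have := hf k
  have := hf m
  have := hf (m + k)
  rw [coherent, coherent, pow_add]
  field_simp
  rw [← h]
  ring

/-- A coherent state stays coherent under the free evolution. -/
theorem freeEvolution_kronecker_coherentProj (hγ : 0 ≤ γ) {t : ℝ} (ht : 0 ≤ t) (A : AtomOp)
    (z : ℂ) : freeEvolution ωA ωc γ t (A ⊗ₖ coherentProj z) =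
      atomEvolution ωA t A ⊗ₖ coherentProj (amplitude ωc γ z t) := by
  ext ⟨a, m⟩ ⟨b, n⟩
  set E := Complex.exp (-Complex.I * ωA * ((a : ℕ) - (b : ℕ) : ℂ) * t)
  set D := Complex.exp ((-Complex.I * ωc - (γ : ℂ) / 2) * t)
  have hexp := Complex.hasSum_ofReal.2
    (NormedSpace.expSeries_div_hasSum_exp (lossProb γ t * ‖z‖ ^ 2))
  rw [← Real.exp_eq_exp_ℝ] at hexp
  -- The scalars left by losing `k` photons are `(q ‖z‖²)^k / k!`. They sum to `e^{q‖z‖²}`, and half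
  -- of this exponent normalizes each of ket and bra.
  have h := hexp.mul_left (E * (D ^ m * star D ^ n) * A a b * coherent z m * star (coherent z n))
  rw [freeEvolution, Matrix.of_apply]
  refine Eq.trans (HasSum.tsum_eq (hasSum_of_forall_eq h fun k => ?_)) ?_
  · rw [mul_right_comm (kraus _ _ _ _ _ _), kraus_mul_star hγ ht, exp_decayRate]
    have h1 := sqrt_choose_mul_coherent z m k
    have h2 := congrArg star (sqrt_choose_mul_coherent z n k)
    have h3 : z ^ k * star z ^ k = ((‖z‖ ^ 2) ^ k : ℝ) := by
      rw [← mul_pow, RCLike.star_def, Complex.mul_conj']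
      push_cast
      rfl
    have h4 : ((√(k.factorial : ℝ) : ℝ) : ℂ) * ((√(k.factorial : ℝ) : ℝ) : ℂ) = k.factorial := by
      rw [← Complex.ofReal_mul, Real.mul_self_sqrt (by positivity)]
      simp
    simp only [star_mul', star_div₀, star_pow, RCLike.star_def, Complex.conj_ofReal] at h2 h3 ⊢
    simp only [Matrix.kroneckerMap_apply, coherentProj, Matrix.of_apply, shift, RCLike.star_def]
    calc _ = E * (D ^ m * (starRingEnd ℂ) D ^ n) * A a b * (lossProb γ t : ℂ) ^ k *
          (((√((m + k).choose k : ℝ) : ℝ) : ℂ) * coherent z (m + k)) *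
          (((√((n + k).choose k : ℝ) : ℝ) : ℂ) * (starRingEnd ℂ) (coherent z (n + k))) := by
          push_cast
          ring
      _ = E * (D ^ m * (starRingEnd ℂ) D ^ n) * A a b * (lossProb γ t : ℂ) ^ k *
          coherent z m * (starRingEnd ℂ) (coherent z n) *
          ((z ^ k * (starRingEnd ℂ) z ^ k) / (((√(k.factorial : ℝ) : ℝ) : ℂ) *
            ((√(k.factorial : ℝ) : ℝ) : ℂ))) := by
          rw [h1, h2]
          ring
      _ = _ := by
          rw [h3, h4]
          push_cast
          ring
  · have h5 : Real.exp (lossProb γ t * ‖z‖ ^ 2) =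
        Real.exp (lossProb γ t * ‖z‖ ^ 2 / 2) * Real.exp (lossProb γ t * ‖z‖ ^ 2 / 2) := by
      rw [← Real.exp_add]
      ring_nf
    simp only [Matrix.kroneckerMap_apply, coherentProj, Matrix.of_apply, atomEvolution,
      coherent_amplitude, h5, star_mul', star_pow, RCLike.star_def, Complex.conj_ofReal,
      Complex.ofReal_mul]
    ring

/-! ### Moments and the first-order cumulant -/

lemma atomEvolution_neg_atomEvolution (ωA t : ℝ) (A : AtomOp) :
    atomEvolution ωA (-t) (atomEvolution ωA t A) = A := by
  ext a b
  simp only [atomEvolution, Matrix.of_apply]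
  rw [← mul_assoc, ← Complex.exp_add]
  simp

lemma atomEvolution_atomEvolution_neg (ωA t : ℝ) (A : AtomOp) :
    atomEvolution ωA t (atomEvolution ωA (-t) A) = A := by
  simpa using atomEvolution_neg_atomEvolution ωA (-t) A

lemma continuous_atomEvolution_apply (ωA : ℝ) (A : AtomOp) (a b : Fin 2) :
    Continuous fun t : ℝ => atomEvolution ωA t A a b := by
  simp only [atomEvolution, Matrix.of_apply]
  fun_prop

lemma partialTrace_proj (z : ℂ) (X : JointOp) : partialTrace (proj z X) = partialTrace X :=
  partialTrace_kronecker_coherentProj _ z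

lemma isTraceClass_proj (z : ℂ) (X : JointOp) : IsTraceClass (proj z X) :=
  isTraceClass_kronecker_coherentProj _ z

lemma proj_kronecker_coherentProj (z : ℂ) (A : AtomOp) :
    proj z (A ⊗ₖ coherentProj z) = A ⊗ₖ coherentProj z := by
  rw [proj, partialTrace_kronecker_coherentProj]

lemma kronecker_coherentProj_mem_projRange (z : ℂ) (A : AtomOp) :
    A ⊗ₖ coherentProj z ∈ projRange z :=
  ⟨_, isTraceClass_kronecker_coherentProj A z, proj_kronecker_coherentProj z A⟩

lemma coherentProj_zero_zero_ne (z : ℂ) : coherentProj z 0 0 ≠ 0 := by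
  simp [coherentProj, coherent, Complex.exp_ne_zero]

/-- `T` is the free evolution on the trace class. -/
def IsFreeEvolution (ωA ωc γ : ℝ) (T : ℝ → JointOp → JointOp) : Prop :=
  ∀ t, 0 ≤ t → ∀ X, IsTraceClass X → T t X = freeEvolution ωA ωc γ t X

/-- The final projector prepares `|z⟩` afresh, so damping of the mode leaves no mark and `𝒪₀`
reduces to the invertible atomic evolution. -/
lemma IsFreeEvolution.moment0_eq (hγ : 0 ≤ γ) (hT : IsFreeEvolution ωA ωc γ T) {t : ℝ}
    (ht : 0 ≤ t) (z : ℂ) (X : JointOp) :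
    moment0 z T t X = atomEvolution ωA t (partialTrace X) ⊗ₖ coherentProj z := by
  have hX := isTraceClass_proj z X
  rw [moment0, hT t ht _ hX, proj, partialTrace_freeEvolution hγ ht hX, partialTrace_proj]

lemma IsFreeEvolution.bijOn_moment0 (hγ : 0 ≤ γ) (hT : IsFreeEvolution ωA ωc γ T) {t : ℝ}
    (ht : 0 ≤ t) (z : ℂ) : Set.BijOn (moment0 z T t) (projRange z) (projRange z) := by
  refine ⟨?_, ?_, ?_⟩
  · intro X _
    rw [hT.moment0_eq hγ ht]
    exact kronecker_coherentProj_mem_projRange z _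
  · rintro _ ⟨X, hX, rfl⟩ _ ⟨Y, hY, rfl⟩ h
    have h' := congrArg (fun Z => atomEvolution ωA (-t) (partialTrace Z)) h
    simp only [hT.moment0_eq hγ ht, partialTrace_kronecker_coherentProj, partialTrace_proj,
      atomEvolution_neg_atomEvolution] at h'
    rw [proj, h', proj]
  · rintro _ ⟨X, hX, rfl⟩
    refine ⟨atomEvolution ωA (-t) (partialTrace X) ⊗ₖ coherentProj z,
      kronecker_coherentProj_mem_projRange z _, ?_⟩
    rw [hT.moment0_eq hγ ht, partialTrace_kronecker_coherentProj, atomEvolution_atomEvolution_neg,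
      proj]

lemma IsFreeEvolution.moment0Inv_eq (hγ : 0 ≤ γ) (hT : IsFreeEvolution ωA ωc γ T) {t : ℝ}
    (ht : 0 ≤ t) (z : ℂ) (X : JointOp) :
    moment0Inv z T t X = atomEvolution ωA (-t) (partialTrace X) ⊗ₖ coherentProj z := by
  have hbij := hT.bijOn_moment0 hγ ht z
  have hmem := kronecker_coherentProj_mem_projRange z (atomEvolution ωA (-t) (partialTrace X))
  -- The value of `invFunOn` is fixed by injectivity: the candidate lies in the range, and `𝒪₀`
  -- sends it to `proj z X`.
  have h := hbij.injOn.leftInvOn_invFunOn hmem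
  rwa [hT.moment0_eq hγ ht, partialTrace_kronecker_coherentProj,
    atomEvolution_atomEvolution_neg] at h

/-- The integrand of the first moment, in the interaction picture. -/
noncomputable def drift (ωA ωc γ : ℝ) (g z : ℂ) (A : AtomOp) (s : ℝ) : AtomOp :=
  (-Complex.I) • ⁅parametricHamiltonian g (amplitude ωc γ z s), atomEvolution ωA s A⁆

lemma continuous_drift_apply (g z : ℂ) (A : AtomOp) (a b : Fin 2) :
    Continuous fun s => drift ωA ωc γ g z A s a b := by
  have hA := continuous_atomEvolution_apply ωA A
  have hamp : Continuous (amplitude ωc γ z) := by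
    unfold amplitude
    fun_prop
  simp only [drift, Ring.lie_def, parametricHamiltonian, Matrix.smul_apply, Matrix.sub_apply,
    Matrix.mul_apply, Matrix.add_apply, smul_eq_mul, Fin.sum_univ_two]
  fun_prop

lemma IsFreeEvolution.interaction_isTraceClass (hγ : 0 ≤ γ) (hT : IsFreeEvolution ωA ωc γ T)
    {s : ℝ} (hs : 0 ≤ s) (g z : ℂ) (X : JointOp) :
    IsTraceClass (interaction g (T s (proj z X))) := by
  rw [hT s hs _ (isTraceClass_proj z X), proj, freeEvolution_kronecker_coherentProj hγ hs]
  exact isTraceClass_interaction g _ _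

lemma IsFreeEvolution.moment1Integrand_eq (hγ : 0 ≤ γ) (hT : IsFreeEvolution ωA ωc γ T)
    {t s : ℝ} (hs : 0 ≤ s) (hst : s ≤ t) (g z : ℂ) (X : JointOp) :
    moment1Integrand g z T t s X =
      atomEvolution ωA (t - s) (drift ωA ωc γ g z (partialTrace X) s) ⊗ₖ coherentProj z := by
  have hI := hT.interaction_isTraceClass hγ hs g z X
  rw [moment1Integrand, hT _ (sub_nonneg.2 hst) _ hI, proj,
    partialTrace_freeEvolution hγ (sub_nonneg.2 hst) hI, hT s hs _ (isTraceClass_proj z X), proj,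
    freeEvolution_kronecker_coherentProj hγ hs, partialTrace_interaction, drift]

/-- The integrated interaction in the interaction picture. -/
noncomputable def integratedDrift (ωA ωc γ : ℝ) (g z : ℂ) (A : AtomOp) (t : ℝ) : AtomOp :=
  Matrix.of fun a b => ∫ s in (0 : ℝ)..t, atomEvolution ωA (-s) (drift ωA ωc γ g z A s) a b

lemma continuous_interactionPicture (g z : ℂ) (A : AtomOp) (a b : Fin 2) :
    Continuous fun s : ℝ => atomEvolution ωA (-s) (drift ωA ωc γ g z A s) a b := by
  have := continuous_drift_apply (ωA := ωA) (ωc := ωc) (γ := γ) g z A a b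
  simp only [atomEvolution, Matrix.of_apply]
  fun_prop

/-- This removes `t` from the integrand of the first moment, so that differentiation in `t` needs
only the product rule and the fundamental theorem of calculus. -/
lemma atomEvolution_sub_apply (ωA t s : ℝ) (A : AtomOp) (a b : Fin 2) :
    atomEvolution ωA (t - s) A a b =
      Complex.exp (-Complex.I * ωA * ((a : ℕ) - (b : ℕ) : ℂ) * t) * atomEvolution ωA (-s) A a b := by
  simp only [atomEvolution, Matrix.of_apply]
  rw [← mul_assoc, ← Complex.exp_add]
  push_cast
  ring_nf

lemma IsFreeEvolution.moment1_eq (hγ : 0 ≤ γ) (hT : IsFreeEvolution ωA ωc γ T) {t : ℝ}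
    (ht : 0 ≤ t) (g z : ℂ) (X : JointOp) : moment1 g z T t X =
      atomEvolution ωA t (integratedDrift ωA ωc γ g z (partialTrace X) t) ⊗ₖ coherentProj z := by
  ext ⟨a, m⟩ ⟨b, n⟩
  rw [moment1, Matrix.of_apply, intervalIntegral.integral_congr
    (g := fun s => Complex.exp (-Complex.I * ωA * ((a : ℕ) - (b : ℕ) : ℂ) * t) *
      atomEvolution ωA (-s) (drift ωA ωc γ g z (partialTrace X) s) a b * coherentProj z m n),
    intervalIntegral.integral_mul_const, intervalIntegral.integral_const_mul]
  · rfl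
  · intro s hs
    rw [Set.uIcc_of_le ht] at hs
    simp only [hT.moment1Integrand_eq hγ hs.1 hs.2, Matrix.kroneckerMap_apply,
      atomEvolution_sub_apply]

lemma IsFreeEvolution.intervalIntegrable_moment1Integrand (hγ : 0 ≤ γ)
    (hT : IsFreeEvolution ωA ωc γ T) {t : ℝ} (ht : 0 ≤ t) (g z : ℂ) (X : JointOp)
    (i j : Fin 2 × ℕ) : IntervalIntegrable (fun s => moment1Integrand g z T t s X i j)
      MeasureTheory.volume 0 t := by
  have hc : Continuous fun s : ℝ => Complex.exp (-Complex.I * ωA *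
      ((i.1 : ℕ) - (j.1 : ℕ) : ℂ) * t) * atomEvolution ωA (-s)
        (drift ωA ωc γ g z (partialTrace X) s) i.1 j.1 * coherentProj z i.2 j.2 := by
    have := continuous_interactionPicture (ωA := ωA) (ωc := ωc) (γ := γ) g z (partialTrace X)
      i.1 j.1
    fun_prop
  refine ContinuousOn.intervalIntegrable (hc.continuousOn.congr fun s hs => ?_)
  rw [Set.uIcc_of_le ht] at hs
  simp only [hT.moment1Integrand_eq hγ hs.1 hs.2, Matrix.kroneckerMap_apply,
    atomEvolution_sub_apply]

lemma hasDerivAt_exp_mul (c : ℂ) (t : ℝ) :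
    HasDerivAt (fun t : ℝ => Complex.exp (c * t)) (Complex.exp (c * t) * c) t := by
  simpa using ((Complex.ofRealCLM.hasDerivAt (x := t)).const_mul c).cexp

/-- The generator of the evolution of the free atom. -/
noncomputable def atomGenerator (ωA : ℝ) (A : AtomOp) : AtomOp :=
  Matrix.of fun a b => -Complex.I * ωA * ((a : ℕ) - (b : ℕ) : ℂ) * A a b

lemma IsFreeEvolution.hasDerivWithinAt_moment0 (hγ : 0 ≤ γ) (hT : IsFreeEvolution ωA ωc γ T)
    {t : ℝ} (ht : 0 ≤ t) (z : ℂ) (X : JointOp) (i j : Fin 2 × ℕ) :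
    HasDerivWithinAt (fun s => moment0 z T s X i j)
      ((atomGenerator ωA (atomEvolution ωA t (partialTrace X)) ⊗ₖ coherentProj z) i j)
      (Set.Ici 0) t := by
  have h := ((hasDerivAt_exp_mul (-Complex.I * ωA * ((i.1 : ℕ) - (j.1 : ℕ) : ℂ)) t).mul_const
    (partialTrace X i.1 j.1)).mul_const (coherentProj z i.2 j.2)
  refine (h.congr_deriv ?_).hasDerivWithinAt.congr (fun s hs => ?_) ?_
  · simp only [Matrix.kroneckerMap_apply, atomGenerator, atomEvolution, Matrix.of_apply]
    ring
  · rw [hT.moment0_eq hγ hs]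
    rfl
  · rw [hT.moment0_eq hγ ht]
    rfl

lemma IsFreeEvolution.hasDerivWithinAt_moment1 (hγ : 0 ≤ γ) (hT : IsFreeEvolution ωA ωc γ T)
    {t : ℝ} (ht : 0 ≤ t) (g z : ℂ) (X : JointOp) (i j : Fin 2 × ℕ) :
    HasDerivWithinAt (fun s => moment1 g z T s X i j)
      (((atomGenerator ωA (atomEvolution ωA t
          (integratedDrift ωA ωc γ g z (partialTrace X) t)) +
        drift ωA ωc γ g z (partialTrace X) t) ⊗ₖ coherentProj z) i j) (Set.Ici 0) t := by
  -- The integrand is continuous on the whole line, so the fundamental theorem applies at `t = 0` as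
  -- well.
  have hJ : HasDerivAt (fun s => integratedDrift ωA ωc γ g z (partialTrace X) s i.1 j.1)
      (atomEvolution ωA (-t) (drift ωA ωc γ g z (partialTrace X) t) i.1 j.1) t :=
    (continuous_interactionPicture g z (partialTrace X) i.1 j.1).integral_hasStrictDerivAt 0 t
      |>.hasDerivAt
  have h := ((hasDerivAt_exp_mul (-Complex.I * ωA * ((i.1 : ℕ) - (j.1 : ℕ) : ℂ)) t).mul
    hJ).mul_const (coherentProj z i.2 j.2)
  refine (h.congr_deriv ?_).hasDerivWithinAt.congr (fun s hs => ?_) ?_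
  · have e (B : AtomOp) : atomEvolution ωA 0 B = B := by
      ext a b
      simp [atomEvolution]
    rw [← atomEvolution_sub_apply, sub_self, e]
    simp only [Matrix.kroneckerMap_apply, atomGenerator, Matrix.of_apply, Matrix.add_apply,
      atomEvolution]
    ring
  · rw [hT.moment1_eq hγ hs]
    rfl
  · rw [hT.moment1_eq hγ ht]
    rfl

lemma IsFreeEvolution.cumulantWellDefined (hγ : 0 ≤ γ) (hT : IsFreeEvolution ωA ωc γ T)
    {t : ℝ} (ht : 0 ≤ t) (g z : ℂ) : CumulantWellDefined g z T t where
  proj_traceClass X _ := isTraceClass_proj z X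
  proj_proj X _ := proj_kronecker_coherentProj z _
  bijOn := hT.bijOn_moment0 hγ ht z
  interaction_traceClass X _ s hs _ := hT.interaction_isTraceClass hγ hs g z X
  integrable X _ i j := hT.intervalIntegrable_moment1Integrand hγ ht g z X i j
  moment1_mem X _ := by
    rw [hT.moment1_eq hγ ht]
    exact kronecker_coherentProj_mem_projRange z _
  differentiable0 X _ i j := (hT.hasDerivWithinAt_moment0 hγ ht z X i j).differentiableWithinAt
  differentiable1 X _ i j := (hT.hasDerivWithinAt_moment1 hγ ht g z X i j).differentiableWithinAt

/-- The first-order cumulant is the parametric approximation with a damped pump. -/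
theorem IsFreeEvolution.cumulant1_eq (hγ : 0 ≤ γ) (hT : IsFreeEvolution ωA ωc γ T) {t : ℝ}
    (ht : 0 ≤ t) (g z : ℂ) (ρ : JointOp) : cumulant1 g z T t ρ = ((-Complex.I) •
      ⁅parametricHamiltonian g (amplitude ωc γ z t), partialTrace ρ⁆) ⊗ₖ coherentProj z := by
  -- Unique differentiability on the half-line makes `derivWithin` equal to the computed
  -- derivatives, including the one-sided one at `0`.
  have hu : UniqueDiffWithinAt ℝ (Set.Ici (0 : ℝ)) t := uniqueDiffOn_Ici 0 t ht
  have h0 (X : JointOp) : timeDeriv (moment0 z T) t X =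
      atomGenerator ωA (atomEvolution ωA t (partialTrace X)) ⊗ₖ coherentProj z := by
    ext i j
    exact (hT.hasDerivWithinAt_moment0 hγ ht z X i j).derivWithin hu
  have h1 (X : JointOp) : timeDeriv (moment1 g z T) t X =
      (atomGenerator ωA (atomEvolution ωA t (integratedDrift ωA ωc γ g z (partialTrace X) t)) +
        drift ωA ωc γ g z (partialTrace X) t) ⊗ₖ coherentProj z := by
    ext i j
    exact (hT.hasDerivWithinAt_moment1 hγ ht g z X i j).derivWithin hu
  rw [cumulant1, h0, h1, hT.moment0Inv_eq hγ ht, hT.moment0Inv_eq hγ ht, hT.moment1_eq hγ ht]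
  simp only [partialTrace_kronecker_coherentProj, atomEvolution_neg_atomEvolution]
  -- The generator term of `𝒪̇₁` equals `𝒪̇₀ 𝒪₀⁻¹ 𝒪₁ 𝒪₀⁻¹` and cancels. In the remaining drift, the
  -- backward evolution from `𝒪₀⁻¹` undoes the forward one.
  rw [Matrix.add_kronecker, add_sub_cancel_left, drift, atomEvolution_atomEvolution_neg]

lemma parametricHamiltonian_amplitude (g z : ℂ) (t : ℝ) :
    parametricHamiltonian g (amplitude ωc γ z t) = Complex.exp (-(γ : ℂ) / 2 * t) •
      ((g * z * Complex.exp (-Complex.I * ωc * t)) • sigmaPlus +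
        (star g * star z * Complex.exp (Complex.I * ωc * t)) • sigmaMinus) := by
  have h1 : Complex.exp ((-Complex.I * ωc - (γ : ℂ) / 2) * t) =
      Complex.exp (-(γ : ℂ) / 2 * t) * Complex.exp (-Complex.I * ωc * t) := by
    rw [← Complex.exp_add]
    ring_nf
  have h2 : star (Complex.exp ((-Complex.I * ωc - (γ : ℂ) / 2) * t)) =
      Complex.exp (-(γ : ℂ) / 2 * t) * Complex.exp (Complex.I * ωc * t) := by
    rw [RCLike.star_def, ← Complex.exp_conj, ← Complex.exp_add]
    congr 1
    simp [map_ofNat]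
    ring
  rw [parametricHamiltonian, amplitude, star_mul', h2, h1, smul_add, smul_smul, smul_smul]
  congr 2 <;> ring

lemma parametricHamiltonian_zero (g : ℂ) : parametricHamiltonian g 0 = 0 := by
  simp [parametricHamiltonian]

/-- The coherence created from the atomic ground state reads off `g w`; this is the test state for
the vanishing criterion. -/
lemma lie_parametricHamiltonian_single (g w : ℂ) :
    ⁅parametricHamiltonian g w, (Matrix.single 0 0 1 : AtomOp)⁆ 1 0 = g * w := by
  simp [parametricHamiltonian, Ring.lie_def, sigmaPlus, sigmaMinus, Matrix.mul_apply,
    Matrix.single, Matrix.vecHead]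

lemma IsFreeEvolution.cumulant1_eq_zero_iff (hγ : 0 ≤ γ) (hT : IsFreeEvolution ωA ωc γ T) {t : ℝ}
    (ht : 0 ≤ t) {g : ℂ} (hg : g ≠ 0) (z : ℂ) :
    (∀ ρ, IsTraceClass ρ → cumulant1 g z T t ρ = 0) ↔ z = 0 := by
  constructor
  · intro h
    have h1 := h _ (isTraceClass_kronecker_coherentProj (Matrix.single 0 0 1) z)
    rw [hT.cumulant1_eq hγ ht, partialTrace_kronecker_coherentProj] at h1
    have h2 := congrFun (congrFun h1 (1, 0)) (0, 0)
    rw [Matrix.kroneckerMap_apply, Matrix.smul_apply, lie_parametricHamiltonian_single] at h2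
    simpa [coherentProj_zero_zero_ne, hg, amplitude, Complex.exp_ne_zero] using h2
  · rintro rfl ρ _
    rw [hT.cumulant1_eq hγ ht, amplitude, zero_mul, parametricHamiltonian_zero, Ring.lie_def,
      zero_mul, mul_zero, sub_zero, smul_zero, Matrix.zero_kronecker]

end DissipativeJC

theorem mainTheorem2 (ωA ωc γ : ℝ) (hγ : 0 ≤ γ) (g z : ℂ) :
    (∃ T, DissipativeJC.IsSemigroupGeneratedBy (DissipativeJC.freeGenerator ωA ωc γ) T) ∧
    ∀ T, DissipativeJC.IsSemigroupGeneratedBy (DissipativeJC.freeGenerator ωA ωc γ) T →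
      (∀ t : ℝ, 0 ≤ t → DissipativeJC.CumulantWellDefined g z T t) ∧
      (∀ t : ℝ, 0 ≤ t → ∀ ρ : DissipativeJC.JointOp, DissipativeJC.IsTraceClass ρ →
        DissipativeJC.cumulant1 g z T t ρ =
          ((-Complex.I * Complex.exp (-(γ : ℂ) / 2 * t)) •
            ⁅(g * z * Complex.exp (-Complex.I * ωc * t)) • DissipativeJC.sigmaPlus +
              (star g * star z * Complex.exp (Complex.I * ωc * t)) • DissipativeJC.sigmaMinus,
              DissipativeJC.partialTrace ρ⁆) ⊗ₖ DissipativeJC.coherentProj z) ∧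
      (∀ t : ℝ, 0 ≤ t → ∀ ρ : DissipativeJC.JointOp, DissipativeJC.IsTraceClass ρ →
        DissipativeJC.cumulant1 g z T t ρ =
          ((-Complex.I) •
            ⁅DissipativeJC.parametricHamiltonian g
                (z * Complex.exp ((-Complex.I * ωc - (γ : ℂ) / 2) * t)),
              DissipativeJC.partialTrace ρ⁆) ⊗ₖ DissipativeJC.coherentProj z) ∧
      (g ≠ 0 → ∀ t : ℝ, 0 ≤ t →
        ((∀ ρ : DissipativeJC.JointOp, DissipativeJC.IsTraceClass ρ →
          DissipativeJC.cumulant1 g z T t ρ = 0) ↔ z = 0)) := by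
  refine ⟨⟨_, DissipativeJC.isSemigroupGeneratedBy_freeEvolution hγ⟩, fun T hT => ?_⟩
  -- By uniqueness, an arbitrary semigroup with this generator may be replaced by the explicit one.
  have hF : DissipativeJC.IsFreeEvolution ωA ωc γ T :=
    fun t ht X hX => hT.eq_freeEvolution hγ ht hX
  refine ⟨fun t ht => hF.cumulantWellDefined hγ ht g z, fun t ht ρ _ => ?_,
    fun t ht ρ _ => hF.cumulant1_eq hγ ht g z ρ,
    fun hg t ht => hF.cumulant1_eq_zero_iff hγ ht hg z⟩
  rw [hF.cumulant1_eq hγ ht, DissipativeJC.parametricHamiltonian_amplitude, Ring.lie_def,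
    Ring.lie_def, smul_mul_assoc, mul_smul_comm, ← smul_sub, smul_smul]
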